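/- Let $q\in\mathbb{C}$ be nonzero and not a root of unity. For elements $a,b$ of an associative algebra, put $[a,b]=ab-ba$. Let $\mathcal{A}$ be the associative unital $\mathbb{C}$-algebra with generators $z,z^*$ and relations $$[z,\;z^2z^*-\beta\,zz^*z+z^*z^2]=\delta\,[z,z^*],\qquad [z^*,\;{z^*}^2z-\beta\,z^*zz^*+z{z^*}^2]=\delta\,[z^*,z],$$ where $\beta=q^2+q^{-2}$ and $\delta=-(q^2-q^{-2})^2$ (the $q$-Onsager algebra). Let $\mathcal{L}=U_q(L(sl_2))$ be the associative unital $\mathbb{C}$-algebra with generators $e_i^+,e_i^-,k_i,k_i^{-1}$ ($i=0,1$) and relations $$k_0k_1=k_1k_0=1,\qquad k_ik_i^{-1}=k_i^{-1}k_i=1,$$ $$k_ie_i^{\pm}k_i^{-1}=q^{\pm2}e_i^{\pm},\qquad k_ie_j^{\pm}k_i^{-1}=q^{\mp2}e_j^{\pm}\quad(i\neq j),$$ $$[e_i^+,e_i^-]=\frac{k_i-k_i^{-1}}{q-q^{-1}},\qquad [e_i^+,e_j^-]=0\quad(i\neq j),$$ $$[e_i^{\pm},\;(e_i^{\pm})^2e_j^{\pm}-(q^2+q^{-2})\,e_i^{\pm}e_j^{\pm}e_i^{\pm}+e_j^{\pm}(e_i^{\pm})^2]=0\quad(i\neq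 j).$$ For nonzero $s,t\in\mathbb{C}$ put $$x(s)=\alpha\,(s\,e_0^++s^{-1}e_1^-k_1)\ \text{ with }\ \alpha=-q^{-1}(q-q^{-1})^2,\qquad y(s)=s\,e_0^-k_0+s^{-1}e_1^+,\qquad k(s)=s\,k_0 .$$ Then for all nonzero $s,t\in\mathbb{C}$ there exists a (unital) $\mathbb{C}$-algebra homomorphism $\varphi_{s,t}:\mathcal{A}\to\mathcal{L}$ such that $$\varphi_{s,t}(z)=x(s)+t\,k(s)+t^{-1}k(s)^{-1},\qquad \varphi_{s,t}(z^*)=y(s)+t^{-1}k(s)+t\,k(s)^{-1}.$$ Moreover, $\varphi_{s,t}$ is injective. -/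

import Mathlib

namespace QOnsager

noncomputable section

/-- The two generators `z`, `z*` of the `q`-Onsager algebra. -/
inductive OnsagerGen : Type
  | z : OnsagerGen
  | zstar : OnsagerGen

/-- The scalar `β = q² + q⁻²`. -/
def beta (q : ℂ) : ℂ := q ^ 2 + (q ^ 2)⁻¹

/-- The scalar `δ = -(q² - q⁻²)²`. -/
def delta (q : ℂ) : ℂ := -(q ^ 2 - (q ^ 2)⁻¹) ^ 2

/-- The defining relations (TD) of the `q`-Onsager algebra, on the free algebra. -/
inductive OnsagerRel (q : ℂ) : FreeAlgebra ℂ OnsagerGen → FreeAlgebra ℂ OnsagerGen → Prop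
  | td_z (Z W : FreeAlgebra ℂ OnsagerGen)
      (hZ : Z = FreeAlgebra.ι ℂ OnsagerGen.z) (hW : W = FreeAlgebra.ι ℂ OnsagerGen.zstar) :
      OnsagerRel q ⁅Z, Z ^ 2 * W - beta q • (Z * W * Z) + W * Z ^ 2⁆ (delta q • ⁅Z, W⁆)
  | td_zstar (Z W : FreeAlgebra ℂ OnsagerGen)
      (hZ : Z = FreeAlgebra.ι ℂ OnsagerGen.z) (hW : W = FreeAlgebra.ι ℂ OnsagerGen.zstar) :
      OnsagerRel q ⁅W, W ^ 2 * Z - beta q • (W * Z * W) + Z * W ^ 2⁆ (delta q • ⁅W, Z⁆)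

/-- The `q`-Onsager algebra `𝒜 = 𝒜_q` over `ℂ`. -/
abbrev OnsagerAlgebra (q : ℂ) : Type := RingQuot (OnsagerRel q)

/-- The generator `z` of the `q`-Onsager algebra. -/
def z (q : ℂ) : OnsagerAlgebra q :=
  RingQuot.mkAlgHom ℂ (OnsagerRel q) (FreeAlgebra.ι ℂ OnsagerGen.z)

/-- The generator `z*` of the `q`-Onsager algebra. -/
def zstar (q : ℂ) : OnsagerAlgebra q :=
  RingQuot.mkAlgHom ℂ (OnsagerRel q) (FreeAlgebra.ι ℂ OnsagerGen.zstar)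

/-- The generators `e_i^+`, `e_i^-`, `k_i`, `k_i⁻¹` (`i = 0, 1`) of the `U_q(sl₂)`-loop algebra. -/
inductive LoopGen : Type
  | ep : Fin 2 → LoopGen
  | em : Fin 2 → LoopGen
  | k : Fin 2 → LoopGen
  | kinv : Fin 2 → LoopGen

/-- `e_i^+` in the free algebra. -/
abbrev fep (i : Fin 2) : FreeAlgebra ℂ LoopGen := FreeAlgebra.ι ℂ (LoopGen.ep i)
/-- `e_i^-` in the free algebra. -/
abbrev fem (i : Fin 2) : FreeAlgebra ℂ LoopGen := FreeAlgebra.ι ℂ (LoopGen.em i)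
/-- `k_i` in the free algebra. -/
abbrev fk (i : Fin 2) : FreeAlgebra ℂ LoopGen := FreeAlgebra.ι ℂ (LoopGen.k i)
/-- `k_i⁻¹` in the free algebra. -/
abbrev fkinv (i : Fin 2) : FreeAlgebra ℂ LoopGen := FreeAlgebra.ι ℂ (LoopGen.kinv i)

/-- The defining relations of the `U_q(sl₂)`-loop algebra, on the free algebra. -/
inductive LoopRel (q : ℂ) : FreeAlgebra ℂ LoopGen → FreeAlgebra ℂ LoopGen → Prop
  | k0_k1 : LoopRel q (fk 0 * fk 1) 1
  | k1_k0 : LoopRel q (fk 1 * fk 0) 1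
  | k_kinv (i : Fin 2) : LoopRel q (fk i * fkinv i) 1
  | kinv_k (i : Fin 2) : LoopRel q (fkinv i * fk i) 1
  | k_ep_same (i : Fin 2) : LoopRel q (fk i * fep i * fkinv i) (q ^ 2 • fep i)
  | k_em_same (i : Fin 2) : LoopRel q (fk i * fem i * fkinv i) ((q ^ 2)⁻¹ • fem i)
  | k_ep_ne (i j : Fin 2) (h : i ≠ j) : LoopRel q (fk i * fep j * fkinv i) ((q ^ 2)⁻¹ • fep j)
  | k_em_ne (i j : Fin 2) (h : i ≠ j) : LoopRel q (fk i * fem j * fkinv i) (q ^ 2 • fem j)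
  | ep_em_same (i : Fin 2) : LoopRel q ⁅fep i, fem i⁆ ((q - q⁻¹)⁻¹ • (fk i - fkinv i))
  | ep_em_ne (i j : Fin 2) (h : i ≠ j) : LoopRel q ⁅fep i, fem j⁆ 0
  | serre_ep (i j : Fin 2) (h : i ≠ j) :
      LoopRel q ⁅fep i, fep i ^ 2 * fep j - (q ^ 2 + (q ^ 2)⁻¹) • (fep i * fep j * fep i)
        + fep j * fep i ^ 2⁆ 0
  | serre_em (i j : Fin 2) (h : i ≠ j) :
      LoopRel q ⁅fem i, fem i ^ 2 * fem j - (q ^ 2 + (q ^ 2)⁻¹) • (fem i * fem j * fem i)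
        + fem j * fem i ^ 2⁆ 0

/-- The `U_q(sl₂)`-loop algebra `ℒ = U_q(L(sl₂))` over `ℂ`. -/
abbrev LoopAlgebra (q : ℂ) : Type := RingQuot (LoopRel q)

/-- The generator `e_i^+` of `ℒ`. -/
def ep (q : ℂ) (i : Fin 2) : LoopAlgebra q := RingQuot.mkAlgHom ℂ (LoopRel q) (fep i)
/-- The generator `e_i^-` of `ℒ`. -/
def em (q : ℂ) (i : Fin 2) : LoopAlgebra q := RingQuot.mkAlgHom ℂ (LoopRel q) (fem i)

/-- The generator `k_i` of `ℒ`, as a unit whose inverse is the generator `k_i⁻¹`. -/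
def k (q : ℂ) (i : Fin 2) : (LoopAlgebra q)ˣ where
  val := RingQuot.mkAlgHom ℂ (LoopRel q) (fk i)
  inv := RingQuot.mkAlgHom ℂ (LoopRel q) (fkinv i)
  val_inv := by
    rw [← map_mul, RingQuot.mkAlgHom_rel ℂ (LoopRel.k_kinv i), map_one]
  inv_val := by
    rw [← map_mul, RingQuot.mkAlgHom_rel ℂ (LoopRel.kinv_k i), map_one]

/-- `k(s) = s k₀`, as a unit of `ℒ` with inverse `s⁻¹ k₀⁻¹`. -/
def kS (q s : ℂ) (hs : s ≠ 0) : (LoopAlgebra q)ˣ where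
  val := s • (k q 0 : LoopAlgebra q)
  inv := s⁻¹ • (((k q 0)⁻¹ : (LoopAlgebra q)ˣ) : LoopAlgebra q)
  val_inv := by
    rw [smul_mul_smul_comm, mul_inv_cancel₀ hs, Units.mul_inv, one_smul]
  inv_val := by
    rw [smul_mul_smul_comm, inv_mul_cancel₀ hs, Units.inv_mul, one_smul]

/-- The scalar `α = -q⁻¹ (q - q⁻¹)²`. -/
def alpha (q : ℂ) : ℂ := -q⁻¹ * (q - q⁻¹) ^ 2

/-- `x(s) = α (s e₀⁺ + s⁻¹ e₁⁻ k₁)`. -/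
def xS (q s : ℂ) : LoopAlgebra q :=
  alpha q • (s • ep q 0 + s⁻¹ • (em q 1 * (k q 1 : LoopAlgebra q)))

/-- `y(s) = s e₀⁻ k₀ + s⁻¹ e₁⁺`. -/
def yS (q s : ℂ) : LoopAlgebra q :=
  s • (em q 0 * (k q 0 : LoopAlgebra q)) + s⁻¹ • ep q 1

/-- `z_t(s) = x(s) + t k(s) + t⁻¹ k(s)⁻¹`. -/
def zT (q s t : ℂ) (hs : s ≠ 0) : LoopAlgebra q :=
  xS q s + t • (kS q s hs : LoopAlgebra q)
    + t⁻¹ • (((kS q s hs)⁻¹ : (LoopAlgebra q)ˣ) : LoopAlgebra q)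

/-- `z*_t(s) = y(s) + t⁻¹ k(s) + t k(s)⁻¹`. -/
def zstarT (q s t : ℂ) (hs : s ≠ 0) : LoopAlgebra q :=
  yS q s + t⁻¹ • (kS q s hs : LoopAlgebra q)
    + t • (((kS q s hs)⁻¹ : (LoopAlgebra q)ˣ) : LoopAlgebra q)

end

end QOnsager

/-!
The elements `x(s)`, `y(s)` and `k(s)` of `ℒ` satisfy the relations of the augmented tridiagonal
algebra: `k(s)` scales `x(s)` and `y(s)` by `q²` and `q⁻²`, and the cubic Serre expression in
`x(s)`, `y(s)` is a multiple of `x² k² - k⁻² x²` (`serreCubic_xS_yS`). Each of these, and the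
deduction of the `q`-Onsager relations from them (`serreCubic_add_cartan`), is an identity of
normally ordered words, obtained by moving letters past each other. This gives the homomorphism.

For injectivity, note that the principal grading of `ℒ` (with `e_i^±` of degree `±1` and `k_i` of
degree `0`) makes multiples of `e₀⁺` and `e₁⁺` the leading terms of the images of `z` and `z*`. The
`q`-Onsager relations are in turn deformations, by terms of lower degree, of the Serre relations. So
it suffices that `e₀⁺` and `e₁⁺` satisfy no relations in `ℒ` beyond consequences of the Serre
relations. This is seen on a lowest weight Verma module: on the space of words in two letters let
`e_i⁺` act by left multiplication by a letter, `k_i` diagonally, and `e_i⁻` by the recursion that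
its commutators with the `e_j⁺` force. The Serre expressions in the `e_i⁻` commute with the `e_j⁺`
and kill the empty word, hence vanish (`serreCubic_lower`). Those in the `e_i⁺` commute with the `e_j⁻`,
so that the ideal they generate is a submodule, and `ℒ` acts on the quotient (`loopAction`).

If now `φ` kills the value in the `q`-Onsager algebra of a combination `v` of words of length at
most `n`, then acting on the empty word shows that the part of `v` in degree `n` lies in the Serre
ideal. Modulo the `q`-Onsager relations it is then a combination of shorter words, and induction on `n`
shows that `v` has value `0` (`injective_of_action`).
-/

namespace QOnsager

noncomputable section

/-! ### The cubic `q`-Serre expression -/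

section Serre

variable {R : Type*} [Ring R] [Algebra ℂ R]

/-- The expression `[x, x²y - (q² + q⁻²) xyx + yx²]`. It vanishes on the Chevalley generators of the
loop algebra, and equals `δ [x, y]` on the generators of the `q`-Onsager algebra. -/
def serreCubic (q : ℂ) (x y : R) : R :=
  ⁅x, x ^ 2 * y - (q ^ 2 + (q ^ 2)⁻¹) • (x * y * x) + y * x ^ 2⁆

theorem serreCubic_add_right (q : ℂ) (x y y' : R) :
    serreCubic q x (y + y') = serreCubic q x y + serreCubic q x y' := by
  simp only [serreCubic, Ring.lie_def, mul_add, add_mul, mul_sub, sub_mul, smul_add, mul_smul_comm,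
    smul_mul_assoc]
  abel

theorem serreCubic_smul_left (q r : ℂ) (x y : R) :
    serreCubic q (r • x) y = r ^ 3 • serreCubic q x y := by
  simp only [serreCubic, Ring.lie_def, pow_two (r • x), pow_two x, mul_add, add_mul, mul_sub,
    sub_mul, mul_smul_comm, smul_mul_assoc, smul_smul]
  match_scalars <;> ring

theorem serreCubic_smul_right (q r : ℂ) (x y : R) :
    serreCubic q x (r • y) = r • serreCubic q x y := by
  simp only [serreCubic, Ring.lie_def, mul_add, add_mul, mul_sub, sub_mul, mul_smul_comm,
    smul_mul_assoc, smul_smul]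
  match_scalars <;> ring

theorem map_serreCubic {S : Type*} [Ring S] [Algebra ℂ S] (f : R →ₐ[ℂ] S) (q : ℂ) (x y : R) :
    f (serreCubic q x y) = serreCubic q (f x) (f y) := by
  simp only [serreCubic, Ring.lie_def, map_sub, map_add, map_mul, map_smul, map_pow]

theorem mul_mul_of_mul_eq_smul {x y w : R} {c : ℂ} (h : x * y = c • (y * x)) :
    x * (y * w) = c • (y * (x * w)) := by
  rw [← mul_assoc, h, smul_mul_assoc, mul_assoc]

/-- Up to a scalar, the cubic Serre expression of two elements is unchanged when they are multiplied
by inverse group-like elements, because each of the four words in it picks up the same scalar. -/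
theorem serreCubic_mul_mul {q : ℂ} (hq : q ≠ 0) {e f k k' : R} (hk : k * k' = 1)
    (hk' : k' * k = 1) (hke : k * e = q ^ 2 • (e * k))
    (hke' : k' * e = (q ^ 2)⁻¹ • (e * k')) (hkf' : k' * f = q ^ 2 • (f * k')) :
    serreCubic q (e * k') (f * k) = serreCubic q e f * k' ^ 2 := by
  have a1 (w : R) : k * (e * w) = q ^ 2 • (e * (k * w)) := mul_mul_of_mul_eq_smul hke
  have a2 (w : R) : k' * (e * w) = (q ^ 2)⁻¹ • (e * (k' * w)) := mul_mul_of_mul_eq_smul hke'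
  have a3 (w : R) : k' * (f * w) = q ^ 2 • (f * (k' * w)) := mul_mul_of_mul_eq_smul hkf'
  have a4 (w : R) : k * (k' * w) = w := by rw [← mul_assoc, hk, one_mul]
  have sq (r : R) : r ^ 2 = r * r := pow_two r
  simp only [serreCubic, Ring.lie_def, sq, mul_add, add_mul, mul_sub, sub_mul, mul_smul_comm,
    smul_mul_assoc, smul_smul, mul_assoc, mul_one, hk', hkf', a1, a2, a3, a4]
  match_scalars <;> field_simp

theorem mul_serreCubic_of_mul_eq_smul {q α β : ℂ} {x y k : R} (hx : k * x = α • (x * k))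
    (hy : k * y = β • (y * k)) :
    k * serreCubic q x y = (α ^ 3 * β) • (serreCubic q x y * k) := by
  have hx' (w : R) : k * (x * w) = α • (x * (k * w)) := mul_mul_of_mul_eq_smul hx
  have hy' (w : R) : k * (y * w) = β • (y * (k * w)) := mul_mul_of_mul_eq_smul hy
  simp only [serreCubic, Ring.lie_def, pow_two x, mul_add, add_mul, mul_sub, sub_mul,
    mul_smul_comm, smul_mul_assoc, smul_smul, mul_assoc, hx, hx', hy, hy']
  match_scalars <;> ring

/-- If `e` is a lowering operator for `x` (with Cartan part `k - k'`) and commutes with `y`, then it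
commutes with the cubic Serre expression in `x` and `y`. -/
theorem commute_serreCubic_of_lie_left {q g : ℂ} (hq : q ≠ 0) {x y e k k' : R}
    (hkx : k * x = q ^ 2 • (x * k)) (hky : k * y = (q ^ 2)⁻¹ • (y * k))
    (hkx' : k' * x = (q ^ 2)⁻¹ • (x * k')) (hky' : k' * y = q ^ 2 • (y * k'))
    (hx : e * x = x * e - g • (k - k')) (hy : e * y = y * e) :
    Commute e (serreCubic q x y) := by
  have a1 (w : R) : k * (x * w) = q ^ 2 • (x * (k * w)) := mul_mul_of_mul_eq_smul hkx
  have a2 (w : R) : k' * (x * w) = (q ^ 2)⁻¹ • (x * (k' * w)) := mul_mul_of_mul_eq_smul hkx'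
  have a3 (w : R) : k * (y * w) = (q ^ 2)⁻¹ • (y * (k * w)) := mul_mul_of_mul_eq_smul hky
  have a4 (w : R) : k' * (y * w) = q ^ 2 • (y * (k' * w)) := mul_mul_of_mul_eq_smul hky'
  have a5 (w : R) : e * (x * w) = x * (e * w) - g • (k * w - k' * w) := by
    rw [← mul_assoc, hx]; simp only [sub_mul, smul_mul_assoc, mul_assoc]
  have a6 (w : R) : e * (y * w) = y * (e * w) := by rw [← mul_assoc, hy, mul_assoc]
  have sq (r : R) : r ^ 2 = r * r := pow_two r
  rw [commute_iff_eq]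
  simp only [serreCubic, Ring.lie_def, sq, mul_add, add_mul, mul_sub, sub_mul, smul_sub,
    mul_smul_comm, smul_mul_assoc, smul_smul, mul_assoc, hx, hy, hkx, hky, hkx', hky',
    a1, a2, a3, a4, a5, a6]
  match_scalars <;> field_simp <;> ring

/-- If `e` is a lowering operator for `y` (with Cartan part `k - k'`) and commutes with `x`, then it
commutes with the cubic Serre expression in `x` and `y`. -/
theorem commute_serreCubic_of_lie_right {q g : ℂ} (hq : q ≠ 0) {x y e k k' : R}
    (hkx : k * x = (q ^ 2)⁻¹ • (x * k)) (hkx' : k' * x = q ^ 2 • (x * k'))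
    (hx : e * x = x * e) (hy : e * y = y * e - g • (k - k')) :
    Commute e (serreCubic q x y) := by
  have a1 (w : R) : k * (x * w) = (q ^ 2)⁻¹ • (x * (k * w)) := mul_mul_of_mul_eq_smul hkx
  have a2 (w : R) : k' * (x * w) = q ^ 2 • (x * (k' * w)) := mul_mul_of_mul_eq_smul hkx'
  have a3 (w : R) : e * (y * w) = y * (e * w) - g • (k * w - k' * w) := by
    rw [← mul_assoc, hy]; simp only [sub_mul, smul_mul_assoc, mul_assoc]
  have a4 (w : R) : e * (x * w) = x * (e * w) := by rw [← mul_assoc, hx, mul_assoc]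
  have sq (r : R) : r ^ 2 = r * r := pow_two r
  rw [commute_iff_eq]
  simp only [serreCubic, Ring.lie_def, sq, mul_add, add_mul, mul_sub, sub_mul, smul_sub,
    mul_smul_comm, smul_mul_assoc, smul_smul, mul_assoc, hx, hy, hkx, hkx', a1, a2, a3, a4]
  match_scalars <;> field_simp <;> ring

end Serre

/-! ### The relations of the augmented tridiagonal algebra -/

section Augmented

variable {R : Type*} [Ring R] [Algebra ℂ R]

/-- The scalar `-q⁴ (q - q⁻¹)(q² - q⁻²)(q³ - q⁻³)` in the cubic relations between `x(s)`, `y(s)` and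
`k(s)`. -/
def augDelta (q : ℂ) : ℂ :=
  -(q ^ 4 * (q - q⁻¹) * (q ^ 2 - (q ^ 2)⁻¹) * (q ^ 3 - (q ^ 3)⁻¹))

theorem serreCubic_add_of_lowering {q g u : ℂ} (hq : q ≠ 0) {a b c m : R}
    (hma : m * a = q ^ 4 • (a * m)) (hmb : m * b = q ^ 4 • (b * m))
    (hba : b * a = (q ^ 2)⁻¹ • (a * b))
    (hca : c * a = q ^ 2 • (a * c) - (q ^ 2 * g) • (m - u • 1))
    (hs : serreCubic q b c = 0) :
    serreCubic q (a + b) c =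
      (g * (q ^ 5 * (q ^ 2 - (q ^ 2)⁻¹) * (q ^ 3 - (q ^ 3)⁻¹))) • ((a + b) ^ 2 * m) := by
  have hmb' (w : R) : m * (b * w) = q ^ 4 • (b * (m * w)) := mul_mul_of_mul_eq_smul hmb
  have hba' (w : R) : b * (a * w) = (q ^ 2)⁻¹ • (a * (b * w)) := mul_mul_of_mul_eq_smul hba
  have hca' (w : R) : c * (a * w) = q ^ 2 • (a * (c * w)) - (q ^ 2 * g) • (m * w - u • w) := by
    rw [← mul_assoc, hca]
    simp only [sub_mul, smul_mul_assoc, mul_assoc, one_mul]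
  have sq (r : R) : r ^ 2 = r * r := pow_two r
  -- All words are written with `a` on the left; what remains in `b`, `c` only is
  -- the Serre relation.
  rw [← sub_zero (serreCubic q (a + b) c), ← hs]
  simp only [serreCubic, Ring.lie_def, sq, mul_add, add_mul, mul_sub, sub_mul, smul_add, smul_sub,
    mul_smul_comm, smul_mul_assoc, smul_smul, mul_assoc, mul_one, hma, hmb, hba, hca,
    hmb', hba', hca']
  match_scalars <;> field_simp <;> ring

theorem serreCubic_add_of_raising {q g u : ℂ} (hq : q ≠ 0) {a b d m : R}
    (ham : m * a = (q ^ 4)⁻¹ • (a * m)) (hbm : m * b = (q ^ 4)⁻¹ • (b * m))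
    (hba : b * a = (q ^ 2)⁻¹ • (a * b))
    (hdb : d * b = (q ^ 2)⁻¹ • (b * d) + g • (m - u • 1))
    (hs : serreCubic q a d = 0) :
    serreCubic q (a + b) d =
      -((g * (q ^ 5 * (q ^ 2 - (q ^ 2)⁻¹) * (q ^ 3 - (q ^ 3)⁻¹))) • (m * (a + b) ^ 2)) := by
  have hma : a * m = q ^ 4 • (m * a) := by rw [ham, smul_inv_smul₀ (pow_ne_zero 4 hq)]
  have hmb : b * m = q ^ 4 • (m * b) := by rw [hbm, smul_inv_smul₀ (pow_ne_zero 4 hq)]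
  have hab : a * b = q ^ 2 • (b * a) := by rw [hba, smul_inv_smul₀ (pow_ne_zero 2 hq)]
  have hma' (w : R) : a * (m * w) = q ^ 4 • (m * (a * w)) := mul_mul_of_mul_eq_smul hma
  have hmb' (w : R) : b * (m * w) = q ^ 4 • (m * (b * w)) := mul_mul_of_mul_eq_smul hmb
  have hab' (w : R) : a * (b * w) = q ^ 2 • (b * (a * w)) := mul_mul_of_mul_eq_smul hab
  have hdb' (w : R) : d * (b * w) = (q ^ 2)⁻¹ • (b * (d * w)) + g • (m * w - u • w) := by
    rw [← mul_assoc, hdb]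
    simp only [sub_mul, add_mul, smul_mul_assoc, mul_assoc, one_mul]
  have sq (r : R) : r ^ 2 = r * r := pow_two r
  -- All words are written with `b` on the left; what remains in `a`, `d` only is
  -- the Serre relation.
  rw [← sub_zero (serreCubic q (a + b) d), ← hs]
  simp only [serreCubic, Ring.lie_def, sq, mul_add, add_mul, mul_sub, sub_mul, smul_add, smul_sub,
    mul_smul_comm, smul_mul_assoc, smul_smul, mul_assoc, mul_one, hma, hmb, hab, hdb,
    hma', hmb', hab', hdb']
  match_scalars <;> field_simp <;> ring

/-- The cubic relation of the augmented tridiagonal algebra, for `x = a + b` and `y = c + d`. Here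
`a`, `b`, `c`, `d` stand for `s e₀⁺`, `s⁻¹ e₁⁻ k₁`, `s e₀⁻ k₀`, `s⁻¹ e₁⁺`, and `m`, `m'` for the
squares of `k(s)` and its inverse. The hypotheses are symmetric under exchanging `a` with `d`, `b` with
`c` and `m` with `m'`, so that the lemma applies to the pair `y`, `x` as well. -/
theorem serreCubic_add_add {q g u u' : ℂ} (hq : q ≠ 0) {a b c d m m' : R}
    (hma : m * a = q ^ 4 • (a * m)) (hmb : m * b = q ^ 4 • (b * m))
    (hma' : m' * a = (q ^ 4)⁻¹ • (a * m')) (hmb' : m' * b = (q ^ 4)⁻¹ • (b * m'))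
    (hba : b * a = (q ^ 2)⁻¹ • (a * b))
    (hca : c * a = q ^ 2 • (a * c) - (q ^ 2 * g) • (m - u • 1))
    (hdb : d * b = (q ^ 2)⁻¹ • (b * d) + g • (m' - u' • 1))
    (hbc : serreCubic q b c = 0) (had : serreCubic q a d = 0) :
    serreCubic q (a + b) (c + d) =
      (g * (q ^ 5 * (q ^ 2 - (q ^ 2)⁻¹) * (q ^ 3 - (q ^ 3)⁻¹))) •
        ((a + b) ^ 2 * m - m' * (a + b) ^ 2) := by
  rw [serreCubic_add_right, serreCubic_add_of_lowering hq hma hmb hba hca hbc,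
    serreCubic_add_of_raising hq hma' hmb' hba hdb had, smul_sub, ← sub_eq_add_neg]

/-- In the augmented tridiagonal algebra the elements `x + t k + t⁻¹ k⁻¹` and `y + t⁻¹ k + t k⁻¹`
satisfy the `q`-Onsager relation. The hypotheses are symmetric under exchanging `x` with `y` and
`k` with `k⁻¹`. -/
theorem serreCubic_add_cartan {q t : ℂ} (hq : q ≠ 0) (ht : t ≠ 0) {x y k k' : R}
    (hk : k * k' = 1) (hk' : k' * k = 1)
    (hkx : k * x = q ^ 2 • (x * k)) (hky : k * y = (q ^ 2)⁻¹ • (y * k))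
    (hkx' : k' * x = (q ^ 2)⁻¹ • (x * k')) (hky' : k' * y = q ^ 2 • (y * k'))
    (hxy : serreCubic q x y = augDelta q • (x ^ 2 * k ^ 2 - k' ^ 2 * x ^ 2)) :
    serreCubic q (x + t • k + t⁻¹ • k') (y + t⁻¹ • k + t • k') =
      delta q • ⁅x + t • k + t⁻¹ • k', y + t⁻¹ • k + t • k'⁆ := by
  have a1 (w : R) : k * (x * w) = q ^ 2 • (x * (k * w)) := mul_mul_of_mul_eq_smul hkx
  have a2 (w : R) : k' * (x * w) = (q ^ 2)⁻¹ • (x * (k' * w)) := mul_mul_of_mul_eq_smul hkx'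
  have a3 (w : R) : k * (y * w) = (q ^ 2)⁻¹ • (y * (k * w)) := mul_mul_of_mul_eq_smul hky
  have a4 (w : R) : k' * (y * w) = q ^ 2 • (y * (k' * w)) := mul_mul_of_mul_eq_smul hky'
  have a5 (w : R) : k * (k' * w) = w := by rw [← mul_assoc, hk, one_mul]
  have a6 (w : R) : k' * (k * w) = w := by rw [← mul_assoc, hk', one_mul]
  have sq (r : R) : r ^ 2 = r * r := pow_two r
  -- All words are written with `k`, `k⁻¹` on the right. The words in three `x` and one `y` cancel
  -- by `hxy`, and the multiple of `x² k² - k⁻² x²` in it cancels the words with two `x`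
  -- and no `y`.
  rw [← sub_eq_zero] at hxy
  rw [← sub_zero (serreCubic q _ _), ← hxy]
  simp only [serreCubic, Ring.lie_def, sq, mul_add, add_mul, mul_sub, sub_mul, smul_add, smul_sub,
    mul_smul_comm, smul_mul_assoc, smul_smul, mul_assoc, mul_one, one_mul, hk, hk', hkx, hky, hkx',
    hky', a1, a2, a3, a4, a5, a6, delta, augDelta]
  match_scalars <;> field_simp <;> ring

end Augmented

/-! ### The homomorphism from the `q`-Onsager algebra to the loop algebra -/

section Loop

variable (q : ℂ)

/-- `k₀` in `ℒ`, which is also `k₁⁻¹`. -/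
abbrev loopK : LoopAlgebra q := (k q 0 : LoopAlgebra q)

/-- `k₀⁻¹` in `ℒ`, which is also `k₁`. -/
abbrev loopKinv : LoopAlgebra q := (((k q 0)⁻¹ : (LoopAlgebra q)ˣ) : LoopAlgebra q)

theorem loopKinv_mul : loopKinv q * loopK q = 1 := Units.inv_mul _

theorem loopK_mul : loopK q * loopKinv q = 1 := Units.mul_inv _

theorem k_one : (k q 1 : LoopAlgebra q) = loopKinv q := by
  have h : (k q 1 : LoopAlgebra q) * (k q 0 : LoopAlgebra q) = 1 := by
    rw [k, k, ← map_mul, RingQuot.mkAlgHom_rel ℂ LoopRel.k1_k0, map_one]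
  rw [← mul_one (k q 1 : LoopAlgebra q), ← loopK_mul q, ← mul_assoc, h, one_mul]

theorem inv_k_one : (((k q 1)⁻¹ : (LoopAlgebra q)ˣ) : LoopAlgebra q) = loopK q := by
  rw [← mul_one (((k q 1)⁻¹ : (LoopAlgebra q)ˣ) : LoopAlgebra q), ← loopKinv_mul q, ← mul_assoc,
    ← k_one, Units.inv_mul, one_mul]

variable {q}

theorem mul_eq_smul_of_conj {R : Type*} [Ring R] [Algebra ℂ R] {κ : Rˣ} {e : R} {c : ℂ}
    (h : (κ : R) * e * ((κ⁻¹ : Rˣ) : R) = c • e) : (κ : R) * e = c • (e * (κ : R)) := by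
  rw [← smul_mul_assoc, ← h, Units.inv_mul_cancel_right]

theorem inv_mul_eq_smul {R : Type*} [Ring R] [Algebra ℂ R] {κ κ' e : R} {c : ℂ} (hc : c ≠ 0)
    (hκ : κ * κ' = 1) (hκ' : κ' * κ = 1) (h : κ * e = c • (e * κ)) : κ' * e = c⁻¹ • (e * κ') := by
  have : κ' * (κ * e) * κ' = κ' * (c • (e * κ)) * κ' := by rw [h]
  rw [← mul_assoc, hκ', one_mul, mul_smul_comm, smul_mul_assoc, mul_assoc, mul_assoc, hκ,
    mul_one] at this
  rw [this, inv_smul_smul₀ hc]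

theorem loopK_ep_zero : loopK q * ep q 0 = q ^ 2 • (ep q 0 * loopK q) :=
  mul_eq_smul_of_conj (by
    rw [k, ep, Units.inv_mk, ← map_mul, ← map_mul, RingQuot.mkAlgHom_rel ℂ (LoopRel.k_ep_same 0),
      map_smul])

theorem loopK_em_zero : loopK q * em q 0 = (q ^ 2)⁻¹ • (em q 0 * loopK q) :=
  mul_eq_smul_of_conj (by
    rw [k, em, Units.inv_mk, ← map_mul, ← map_mul, RingQuot.mkAlgHom_rel ℂ (LoopRel.k_em_same 0),
      map_smul])

theorem loopK_ep_one : loopK q * ep q 1 = (q ^ 2)⁻¹ • (ep q 1 * loopK q) :=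
  mul_eq_smul_of_conj (by
    rw [k, ep, Units.inv_mk, ← map_mul, ← map_mul,
      RingQuot.mkAlgHom_rel ℂ (LoopRel.k_ep_ne 0 1 (by decide)), map_smul])

theorem loopK_em_one : loopK q * em q 1 = q ^ 2 • (em q 1 * loopK q) :=
  mul_eq_smul_of_conj (by
    rw [k, em, Units.inv_mk, ← map_mul, ← map_mul,
      RingQuot.mkAlgHom_rel ℂ (LoopRel.k_em_ne 0 1 (by decide)), map_smul])

theorem ep_mul_em_self (i : Fin 2) : ep q i * em q i = em q i * ep q i +
    (q - q⁻¹)⁻¹ • ((k q i : LoopAlgebra q) - (((k q i)⁻¹ : (LoopAlgebra q)ˣ) : LoopAlgebra q)) := by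
  have h := RingQuot.mkAlgHom_rel ℂ (LoopRel.ep_em_same (q := q) i)
  rw [Ring.lie_def, map_sub, map_mul, map_mul, map_smul, map_sub] at h
  exact sub_eq_iff_eq_add'.mp h

theorem ep_mul_em_of_ne {i j : Fin 2} (hij : i ≠ j) : ep q i * em q j = em q j * ep q i := by
  have h := RingQuot.mkAlgHom_rel ℂ (LoopRel.ep_em_ne (q := q) i j hij)
  rw [Ring.lie_def, map_sub, map_mul, map_mul, map_zero] at h
  exact sub_eq_zero.mp h

theorem serreCubic_ep {i j : Fin 2} (hij : i ≠ j) : serreCubic q (ep q i) (ep q j) = 0 := by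
  have h := RingQuot.mkAlgHom_rel ℂ (LoopRel.serre_ep (q := q) i j hij)
  rw [map_zero] at h
  rw [ep, ep, ← map_serreCubic]
  exact h

theorem serreCubic_em {i j : Fin 2} (hij : i ≠ j) : serreCubic q (em q i) (em q j) = 0 := by
  have h := RingQuot.mkAlgHom_rel ℂ (LoopRel.serre_em (q := q) i j hij)
  rw [map_zero] at h
  rw [em, em, ← map_serreCubic]
  exact h

end Loop

section Hom

variable {q s : ℂ}

theorem loopKinv_gens (hq : q ≠ 0) :
    loopKinv q * ep q 0 = (q ^ 2)⁻¹ • (ep q 0 * loopKinv q) ∧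
    loopKinv q * em q 0 = q ^ 2 • (em q 0 * loopKinv q) ∧
    loopKinv q * ep q 1 = q ^ 2 • (ep q 1 * loopKinv q) ∧
    loopKinv q * em q 1 = (q ^ 2)⁻¹ • (em q 1 * loopKinv q) := by
  have h2 : q ^ 2 ≠ 0 := pow_ne_zero 2 hq
  have key {e : LoopAlgebra q} {c : ℂ} (hc : c ≠ 0) (h : loopK q * e = c • (e * loopK q)) :=
    inv_mul_eq_smul hc (loopK_mul q) (loopKinv_mul q) h
  refine ⟨key h2 loopK_ep_zero, ?_, ?_, key h2 loopK_em_one⟩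
  · simpa using key (inv_ne_zero h2) loopK_em_zero
  · simpa using key (inv_ne_zero h2) loopK_ep_one

theorem val_kS (hs : s ≠ 0) : (kS q s hs : LoopAlgebra q) = s • loopK q := rfl

theorem val_inv_kS (hs : s ≠ 0) :
    (((kS q s hs)⁻¹ : (LoopAlgebra q)ˣ) : LoopAlgebra q) = s⁻¹ • loopKinv q := rfl

theorem kS_mul_xS (hs : s ≠ 0) :
    (kS q s hs : LoopAlgebra q) * xS q s = q ^ 2 • (xS q s * (kS q s hs : LoopAlgebra q)) := by
  have h1 : loopK q * (em q 1 * loopKinv q) = q ^ 2 • (em q 1 * loopKinv q * loopK q) := by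
    rw [← mul_assoc, loopK_em_one, smul_mul_assoc, mul_assoc, mul_assoc, loopK_mul, loopKinv_mul]
  rw [val_kS, xS, k_one]
  simp only [mul_add, add_mul, smul_add, mul_smul_comm, smul_mul_assoc, loopK_ep_zero, h1]
  module

theorem kS_mul_yS (hs : s ≠ 0) :
    (kS q s hs : LoopAlgebra q) * yS q s = (q ^ 2)⁻¹ • (yS q s * (kS q s hs : LoopAlgebra q)) := by
  have h1 : loopK q * (em q 0 * loopK q) = (q ^ 2)⁻¹ • (em q 0 * loopK q * loopK q) := by
    rw [← mul_assoc, loopK_em_zero, smul_mul_assoc]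
  rw [val_kS, yS]
  simp only [mul_add, add_mul, smul_add, mul_smul_comm, smul_mul_assoc, loopK_ep_one, h1]
  module

theorem sq_mul_eq_smul {R : Type*} [Ring R] [Algebra ℂ R] {κ e : R} {c : ℂ}
    (h : κ * e = c • (e * κ)) : κ ^ 2 * e = c ^ 2 • (e * κ ^ 2) := by
  rw [pow_two κ, mul_assoc, h, mul_smul_comm, ← mul_assoc, h, smul_mul_assoc, mul_assoc, smul_smul,
    pow_two c]

theorem sub_inv_ne_zero (hq : q ≠ 0) (hq1 : q ^ 2 ≠ 1) : q - q⁻¹ ≠ 0 := fun h => hq1 (by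
  rw [pow_two]; nth_rewrite 2 [sub_eq_zero.mp h]; exact mul_inv_cancel₀ hq)

theorem alpha_mul_eq_augDelta (hq : q ≠ 0) (hq1 : q ^ 2 ≠ 1) :
    alpha q * ((q - q⁻¹)⁻¹ * (q ^ 5 * (q ^ 2 - (q ^ 2)⁻¹) * (q ^ 3 - (q ^ 3)⁻¹))) =
      augDelta q := by
  have h := sub_inv_ne_zero hq hq1
  have e : (q - q⁻¹) ^ 2 * (q - q⁻¹)⁻¹ = q - q⁻¹ := by
    rw [pow_two, mul_assoc, mul_inv_cancel₀ h, mul_one]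
  have e5 : q⁻¹ * q ^ 5 = q ^ 4 := by field_simp
  rw [alpha, augDelta]
  linear_combination (-(q⁻¹ * q ^ 5 * (q ^ 2 - (q ^ 2)⁻¹) * (q ^ 3 - (q ^ 3)⁻¹))) * e -
    (q - q⁻¹) * (q ^ 2 - (q ^ 2)⁻¹) * (q ^ 3 - (q ^ 3)⁻¹) * e5

/-- The cubic relations of the augmented tridiagonal algebra hold for `x(s)`, `y(s)` and `k(s)`. The
hypotheses of `serreCubic_add_add` are verified with `u = s²`, `u' = s⁻²`. -/
theorem serreCubic_xS_yS (hq : q ≠ 0) (hq1 : q ^ 2 ≠ 1) (hs : s ≠ 0) :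
    serreCubic q (xS q s) (yS q s) = augDelta q • (xS q s ^ 2 * (kS q s hs : LoopAlgebra q) ^ 2
      - (((kS q s hs)⁻¹ : (LoopAlgebra q)ˣ) : LoopAlgebra q) ^ 2 * xS q s ^ 2) ∧
    serreCubic q (yS q s) (xS q s) = augDelta q •
      (yS q s ^ 2 * (((kS q s hs)⁻¹ : (LoopAlgebra q)ˣ) : LoopAlgebra q) ^ 2
        - (kS q s hs : LoopAlgebra q) ^ 2 * yS q s ^ 2) := by
  obtain ⟨he0, hf0, he1, hf1⟩ := loopKinv_gens hq
  have hk := loopK_mul q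
  have hk' := loopKinv_mul q
  set K := loopK q
  set K' := loopKinv q
  set a := s • ep q 0 with ha
  set b := s⁻¹ • (em q 1 * K') with hb
  set c := s • (em q 0 * K) with hc
  set d := s⁻¹ • ep q 1 with hd
  set κ : LoopAlgebra q := s • K with hκ
  set κ' : LoopAlgebra q := s⁻¹ • K' with hκ'
  have hx : xS q s = alpha q • (a + b) := by rw [xS, k_one]
  have hy : yS q s = c + d := rfl
  have hkS : (kS q s hs : LoopAlgebra q) = κ := val_kS hs
  have hkS' : (((kS q s hs)⁻¹ : (LoopAlgebra q)ˣ) : LoopAlgebra q) = κ' := val_inv_kS hs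
  have hκκ : κ * κ' = 1 := hkS' ▸ hkS ▸ Units.mul_inv _
  have hκκ' : κ' * κ = 1 := hkS' ▸ hkS ▸ Units.inv_mul _
  have h2 : q ^ 2 ≠ 0 := pow_ne_zero 2 hq
  have p4 : (q ^ 2) ^ 2 = q ^ 4 := by ring
  have p4' : ((q ^ 2)⁻¹) ^ 2 = (q ^ 4)⁻¹ := by rw [inv_pow, p4]
  have ka : κ * a = q ^ 2 • (a * κ) := by
    simp only [ha, hκ, smul_mul_assoc, mul_smul_comm, K, loopK_ep_zero]; module
  have kb : κ * b = q ^ 2 • (b * κ) := by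
    simp only [hb, hκ, smul_mul_assoc, mul_smul_comm, K, ← mul_assoc, loopK_em_one]
    simp only [K', mul_assoc, loopK_mul, loopKinv_mul]
    module
  have kc : κ * c = (q ^ 2)⁻¹ • (c * κ) := by
    simp only [hc, hκ, smul_mul_assoc, mul_smul_comm, K, ← mul_assoc, loopK_em_zero]
    module
  have kd : κ * d = (q ^ 2)⁻¹ • (d * κ) := by
    simp only [hd, hκ, smul_mul_assoc, mul_smul_comm, K, loopK_ep_one]; module
  have ka' : κ' * a = (q ^ 2)⁻¹ • (a * κ') := inv_mul_eq_smul h2 hκκ hκκ' ka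
  have kb' : κ' * b = (q ^ 2)⁻¹ • (b * κ') := inv_mul_eq_smul h2 hκκ hκκ' kb
  have kc' : κ' * c = q ^ 2 • (c * κ') := by
    simpa using inv_mul_eq_smul (inv_ne_zero h2) hκκ hκκ' kc
  have kd' : κ' * d = q ^ 2 • (d * κ') := by
    simpa using inv_mul_eq_smul (inv_ne_zero h2) hκκ hκκ' kd
  have hba : b * a = (q ^ 2)⁻¹ • (a * b) := by
    simp only [ha, hb, smul_mul_assoc, mul_smul_comm, mul_assoc, he0]
    rw [← mul_assoc, ← mul_assoc, ep_mul_em_of_ne (by decide)]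
    module
  have hcd : c * d = (q ^ 2)⁻¹ • (d * c) := by
    simp only [hc, hd, smul_mul_assoc, mul_smul_comm, mul_assoc, K, loopK_ep_one]
    rw [← mul_assoc, ← mul_assoc, ep_mul_em_of_ne (by decide)]
    module
  have hac : a * c = (q ^ 2)⁻¹ • (c * a) + (q - q⁻¹)⁻¹ • (κ ^ 2 - (s ^ 2) • 1) := by
    have h : ep q 0 * (em q 0 * K) =
        (q ^ 2)⁻¹ • (em q 0 * K * ep q 0) + (q - q⁻¹)⁻¹ • (K * K - 1) := by
      rw [← mul_assoc, ep_mul_em_self, add_mul, smul_mul_assoc, sub_mul, hk', mul_assoc (em q 0) K,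
        loopK_ep_zero, mul_smul_comm, inv_smul_smul₀ h2, mul_assoc]
    simp only [ha, hc, hκ, smul_mul_assoc, mul_smul_comm, pow_two (s • K), h]
    module
  have hdb : d * b = (q ^ 2)⁻¹ • (b * d) + (q - q⁻¹)⁻¹ • (κ' ^ 2 - ((s ^ 2)⁻¹) • 1) := by
    have h : ep q 1 * (em q 1 * K') =
        (q ^ 2)⁻¹ • (em q 1 * K' * ep q 1) + (q - q⁻¹)⁻¹ • (K' * K' - 1) := by
      rw [← mul_assoc, ep_mul_em_self, add_mul, smul_mul_assoc, sub_mul, k_one, inv_k_one, hk,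
        mul_assoc (em q 1) K', he1, mul_smul_comm, inv_smul_smul₀ h2, mul_assoc]
    simp only [hb, hd, hκ', smul_mul_assoc, mul_smul_comm, pow_two (s⁻¹ • K'), h]
    module
  have hca : c * a = q ^ 2 • (a * c) - (q ^ 2 * (q - q⁻¹)⁻¹) • (κ ^ 2 - (s ^ 2) • 1) := by
    rw [hac, smul_add, smul_inv_smul₀ h2, smul_smul, add_sub_cancel_right]
  have hbd : b * d = q ^ 2 • (d * b) - (q ^ 2 * (q - q⁻¹)⁻¹) • (κ' ^ 2 - ((s ^ 2)⁻¹) • 1) := by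
    rw [hdb, smul_add, smul_inv_smul₀ h2, smul_smul, add_sub_cancel_right]
  have had : serreCubic q a d = 0 := by
    rw [ha, hd, serreCubic_smul_left, serreCubic_smul_right, serreCubic_ep (by decide), smul_zero,
      smul_zero]
  have hda : serreCubic q d a = 0 := by
    rw [ha, hd, serreCubic_smul_left, serreCubic_smul_right, serreCubic_ep (by decide), smul_zero,
      smul_zero]
  have hbc : serreCubic q b c = 0 := by
    rw [hb, hc, serreCubic_smul_left, serreCubic_smul_right,
      serreCubic_mul_mul hq hk hk' loopK_em_one hf1 hf0, serreCubic_em (by decide), zero_mul,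
      smul_zero, smul_zero]
  have hcb : serreCubic q c b = 0 := by
    rw [hb, hc, serreCubic_smul_left, serreCubic_smul_right,
      serreCubic_mul_mul hq hk' hk hf0 loopK_em_zero loopK_em_one, serreCubic_em (by decide),
      zero_mul, smul_zero, smul_zero]
  rw [hkS, hkS', hx, hy, ← alpha_mul_eq_augDelta hq hq1]
  constructor
  · rw [serreCubic_smul_left, serreCubic_add_add hq (p4 ▸ sq_mul_eq_smul ka)
      (p4 ▸ sq_mul_eq_smul kb) (p4' ▸ sq_mul_eq_smul ka') (p4' ▸ sq_mul_eq_smul kb') hba hca hdb hbc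
      had]
    simp only [smul_pow, smul_mul_assoc, mul_smul_comm]
    module
  · rw [serreCubic_smul_right, add_comm c d, add_comm a b,
      serreCubic_add_add hq (p4 ▸ sq_mul_eq_smul kd') (p4 ▸ sq_mul_eq_smul kc')
      (p4' ▸ sq_mul_eq_smul kd) (p4' ▸ sq_mul_eq_smul kc) hcd hbd hac hcb hda]
    module

variable {t : ℂ}

/-- The two defining relations of the `q`-Onsager algebra hold for `z_t(s)` and `z*_t(s)`. -/
theorem serreCubic_zT_zstarT (hq : q ≠ 0) (hq1 : q ^ 2 ≠ 1) (hs : s ≠ 0) (ht : t ≠ 0) :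
    serreCubic q (zT q s t hs) (zstarT q s t hs) = delta q • ⁅zT q s t hs, zstarT q s t hs⁆ ∧
    serreCubic q (zstarT q s t hs) (zT q s t hs) = delta q • ⁅zstarT q s t hs, zT q s t hs⁆ := by
  have h2 : q ^ 2 ≠ 0 := pow_ne_zero 2 hq
  obtain ⟨hxy, hyx⟩ := serreCubic_xS_yS hq hq1 hs
  have hk : (kS q s hs : LoopAlgebra q) *
      (((kS q s hs)⁻¹ : (LoopAlgebra q)ˣ) : LoopAlgebra q) = 1 :=
    Units.mul_inv _
  have hk' : (((kS q s hs)⁻¹ : (LoopAlgebra q)ˣ) : LoopAlgebra q) *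
      (kS q s hs : LoopAlgebra q) = 1 :=
    Units.inv_mul _
  have hx := kS_mul_xS (q := q) hs
  have hy := kS_mul_yS (q := q) hs
  have hx' := inv_mul_eq_smul h2 hk hk' hx
  have hy' := inv_mul_eq_smul (inv_ne_zero h2) hk hk' hy
  rw [inv_inv] at hy'
  rw [zT, zstarT]
  refine ⟨serreCubic_add_cartan hq ht hk hk' hx hy hx' hy' hxy, ?_⟩
  have h := serreCubic_add_cartan hq ht hk' hk hy' hx' hy hx hyx
  rwa [add_right_comm (yS q s), add_right_comm (xS q s)] at h

/-- The homomorphism `φ_{s,t}` from the `q`-Onsager algebra to the loop algebra. -/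
def onsagerToLoop (hq : q ≠ 0) (hq1 : q ^ 2 ≠ 1) (hs : s ≠ 0) (ht : t ≠ 0) :
    OnsagerAlgebra q →ₐ[ℂ] LoopAlgebra q :=
  RingQuot.liftAlgHom ℂ ⟨FreeAlgebra.lift ℂ fun
    | .z => zT q s t hs
    | .zstar => zstarT q s t hs, by
    obtain ⟨h1, h2⟩ := serreCubic_zT_zstarT hq hq1 hs ht
    rintro _ _ (⟨Z, W, rfl, rfl⟩ | ⟨Z, W, rfl, rfl⟩)
    · refine (map_serreCubic _ q _ _).trans ?_
      simpa only [map_smul, Ring.lie_def, map_sub, map_mul, FreeAlgebra.lift_ι_apply] using h1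
    · refine (map_serreCubic _ q _ _).trans ?_
      simpa only [map_smul, Ring.lie_def, map_sub, map_mul, FreeAlgebra.lift_ι_apply] using h2⟩

theorem onsagerToLoop_z (hq : q ≠ 0) (hq1 : q ^ 2 ≠ 1) (hs : s ≠ 0) (ht : t ≠ 0) :
    onsagerToLoop hq hq1 hs ht (z q) = zT q s t hs := by
  rw [onsagerToLoop, z, RingQuot.liftAlgHom_mkAlgHom_apply, FreeAlgebra.lift_ι_apply]

theorem onsagerToLoop_zstar (hq : q ≠ 0) (hq1 : q ^ 2 ≠ 1) (hs : s ≠ 0) (ht : t ≠ 0) :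
    onsagerToLoop hq hq1 hs ht (zstar q) = zstarT q s t hs := by
  rw [onsagerToLoop, zstar, RingQuot.liftAlgHom_mkAlgHom_apply, FreeAlgebra.lift_ι_apply]

end Hom

/-! ### Operators on the space of words -/

/-- The vector space spanned by the words in two letters. It carries a Verma type module of the
algebra with the relations of `ℒ` other than the Serre relations. -/
abbrev WordSpace : Type := List (Fin 2) →₀ ℂ

/-- The basis vector of a word. -/
abbrev word (w : List (Fin 2)) : WordSpace := Finsupp.single w 1

/-- Two operators agree if their agreement propagates from each word to its extensions by a
letter. -/
theorem end_ext_word {A B : Module.End ℂ WordSpace} (h0 : A (word []) = B (word []))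
    (h : ∀ j w, A (word w) = B (word w) → A (word (j :: w)) = B (word (j :: w))) : A = B := by
  refine Finsupp.lhom_ext' fun w => LinearMap.ext_ring ?_
  change A (word w) = B (word w)
  induction w with
  | nil => exact h0
  | cons j w ih => exact h j w ih

/-- Left multiplication by a letter. -/
def raise (j : Fin 2) : Module.End ℂ WordSpace := Finsupp.lmapDomain ℂ ℂ (List.cons j)

theorem raise_word (j : Fin 2) (w : List (Fin 2)) : raise j (word w) = word (j :: w) :=
  Finsupp.mapDomain_single

/-- The diagonal operator that multiplies a word by the product of the weights of its letters. -/
def twist (c : Fin 2 → ℂ) : Module.End ℂ WordSpace :=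
  Finsupp.linearCombination ℂ fun w => (w.map c).prod • word w

theorem twist_word (c : Fin 2 → ℂ) (w : List (Fin 2)) :
    twist c (word w) = (w.map c).prod • word w := by
  rw [twist, Finsupp.linearCombination_single, one_smul]

theorem twist_mul_raise (c : Fin 2 → ℂ) (j : Fin 2) :
    twist c * raise j = c j • (raise j * twist c) := by
  refine Finsupp.lhom_ext' fun w => LinearMap.ext_ring ?_
  change twist c (raise j (word w)) = c j • raise j (twist c (word w))
  rw [raise_word, twist_word, twist_word, map_smul, raise_word, List.map_cons, List.prod_cons,
    mul_smul]

theorem twist_raise (c : Fin 2 → ℂ) (j : Fin 2) (v : WordSpace) :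
    twist c (raise j v) = c j • raise j (twist c v) :=
  LinearMap.congr_fun (twist_mul_raise c j) v

theorem twist_mul_twist (c d : Fin 2 → ℂ) : twist c * twist d = twist (c * d) := by
  refine Finsupp.lhom_ext' fun w => LinearMap.ext_ring ?_
  change twist c (twist d (word w)) = twist (c * d) (word w)
  rw [twist_word, map_smul, twist_word, twist_word, smul_smul]
  congr 1
  induction w with
  | nil => simp
  | cons j w ih =>
    simp only [List.map_cons, List.prod_cons, Pi.mul_apply, ← ih]
    ring

theorem twist_one : twist 1 = 1 := by
  refine Finsupp.lhom_ext' fun w => LinearMap.ext_ring ?_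
  change twist 1 (word w) = word w
  rw [twist_word, List.prod_eq_one (by simp), one_smul]

variable (q : ℂ)

/-- The weights of the two letters under `k_i`: the eigenvalue of `k_i` on the letter `j` is `q²` if
`i = j` and `q⁻²` otherwise. -/
def letterWeight (i j : Fin 2) : ℂ := if i = j then q ^ 2 else (q ^ 2)⁻¹

theorem letterWeight_self (i : Fin 2) : letterWeight q i i = q ^ 2 := if_pos rfl

theorem letterWeight_of_ne {i j : Fin 2} (h : i ≠ j) : letterWeight q i j = (q ^ 2)⁻¹ := if_neg h

theorem letterWeight_zero_inv : (letterWeight q 0)⁻¹ = letterWeight q 1 := by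
  ext j
  fin_cases j <;> simp [letterWeight]

variable {q} in
theorem letterWeight_ne_zero (hq : q ≠ 0) (i j : Fin 2) : letterWeight q i j ≠ 0 := by
  rw [letterWeight]
  split_ifs
  · exact pow_ne_zero 2 hq
  · exact inv_ne_zero (pow_ne_zero 2 hq)

/-- The action of `k_i` on the space of words. -/
abbrev cartan (i : Fin 2) : Module.End ℂ WordSpace := twist (letterWeight q i)

/-- The action of `k_i⁻¹` on the space of words. -/
abbrev cartanInv (i : Fin 2) : Module.End ℂ WordSpace := twist (letterWeight q i)⁻¹

/-- The image of a word under the lowering operator `lower q i`. -/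
def lowerWord (i : Fin 2) : List (Fin 2) → WordSpace
  | [] => 0
  | j :: w => raise j (lowerWord i w) -
      if i = j then (q - q⁻¹)⁻¹ • (cartan q i (word w) - cartanInv q i (word w)) else 0

/-- The action of `e_i⁻` on the space of words: it kills the empty word, and its commutators with
the operators `raise j` are those prescribed by the relations of `ℒ`. -/
def lower (i : Fin 2) : Module.End ℂ WordSpace := Finsupp.linearCombination ℂ (lowerWord q i)

theorem lower_word (i : Fin 2) (w : List (Fin 2)) : lower q i (word w) = lowerWord q i w := by
  rw [lower, Finsupp.linearCombination_single, one_smul]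

theorem lower_nil (i : Fin 2) : lower q i (word []) = 0 := lower_word q i []

theorem lower_mul_raise_self (i : Fin 2) : lower q i * raise i =
    raise i * lower q i - (q - q⁻¹)⁻¹ • (cartan q i - cartanInv q i) := by
  refine Finsupp.lhom_ext' fun w => LinearMap.ext_ring ?_
  change lower q i (raise i (word w)) = raise i (lower q i (word w)) -
    (q - q⁻¹)⁻¹ • (cartan q i (word w) - cartanInv q i (word w))
  rw [raise_word, lower_word, lower_word, lowerWord, if_pos rfl]

theorem lower_mul_raise_of_ne {i j : Fin 2} (h : i ≠ j) :
    lower q i * raise j = raise j * lower q i := by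
  refine Finsupp.lhom_ext' fun w => LinearMap.ext_ring ?_
  change lower q i (raise j (word w)) = raise j (lower q i (word w))
  rw [raise_word, lower_word, lower_word, lowerWord, if_neg h, sub_zero]

theorem twist_mul_lower {c : Fin 2 → ℂ} {i : Fin 2} (hc : c i ≠ 0) :
    twist c * lower q i = (c i)⁻¹ • (lower q i * twist c) := by
  refine end_ext_word ?_ fun j w h => ?_
  · change twist c (lower q i (word [])) = (c i)⁻¹ • lower q i (twist c (word []))
    rw [lower_nil, twist_word, map_smul, lower_nil, smul_zero, smul_zero, map_zero]
  · change twist c (lower q i (word w)) = (c i)⁻¹ • lower q i (twist c (word w)) at h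
    change twist c (lower q i (word (j :: w))) = (c i)⁻¹ • lower q i (twist c (word (j :: w)))
    rw [twist_word, map_smul, lower_word] at h
    rw [twist_word, map_smul, lower_word, lowerWord, map_sub, twist_raise, h, List.map_cons,
      List.prod_cons]
    split_ifs with hij
    · subst hij
      simp only [map_smul, map_sub, twist_word]
      match_scalars <;> field_simp
    · simp only [map_smul, map_zero]
      module

variable {q}

/-- The operators `lower q i` satisfy the Serre relation: the cubic expression in them commutes with
every `raise k` and kills the empty word. -/
theorem serreCubic_lower (hq : q ≠ 0) {i j : Fin 2} (hij : i ≠ j) :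
    serreCubic q (lower q i) (lower q j) = 0 := by
  have hw := letterWeight_ne_zero hq
  have hw' (a b : Fin 2) : (letterWeight q a)⁻¹ b ≠ 0 := inv_ne_zero (hw a b)
  have hcomm (m : Fin 2) : Commute (raise m) (serreCubic q (lower q i) (lower q j)) := by
    have hself : raise m * lower q m =
        lower q m * raise m - (q - q⁻¹)⁻¹ • (cartanInv q m - cartan q m) := by
      rw [lower_mul_raise_self]
      module
    by_cases hm : m = i
    · subst hm
      refine commute_serreCubic_of_lie_left hq (k := cartanInv q m) (k' := cartan q m) ?_ ?_ ?_ ?_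
        hself (lower_mul_raise_of_ne q hij.symm).symm <;>
      rw [twist_mul_lower q (by first | exact hw _ _ | exact hw' _ _)] <;>
      simp only [Pi.inv_apply, letterWeight_self, letterWeight_of_ne q hij, inv_inv]
    · obtain rfl : m = j := by omega
      refine commute_serreCubic_of_lie_right hq (k := cartanInv q m) (k' := cartan q m) ?_ ?_
        (lower_mul_raise_of_ne q hij).symm hself <;>
      rw [twist_mul_lower q (by first | exact hw _ _ | exact hw' _ _)] <;>
      simp only [Pi.inv_apply, letterWeight_of_ne q hij.symm, inv_inv]
  refine end_ext_word ?_ fun m w h => ?_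
  · simp only [serreCubic, Ring.lie_def, LinearMap.sub_apply, LinearMap.add_apply,
      LinearMap.smul_apply, Module.End.mul_apply, pow_two (lower q i), lower_nil, map_zero,
      smul_zero, sub_zero, add_zero, LinearMap.zero_apply]
  · have := LinearMap.congr_fun (hcomm m) (word w)
    rw [Module.End.mul_apply, Module.End.mul_apply, h, raise_word, LinearMap.zero_apply,
      map_zero] at this
    exact this.symm

/-- This makes the Serre submodule stable under the action of the `e_i⁻`. -/
theorem commute_lower_serreCubic_raise (hq : q ≠ 0) {i j : Fin 2} (hij : i ≠ j) (m : Fin 2) :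
    Commute (lower q m) (serreCubic q (raise i) (raise j)) := by
  by_cases hm : m = i
  · subst hm
    refine commute_serreCubic_of_lie_left hq (k := cartan q m) (k' := cartanInv q m) ?_ ?_ ?_ ?_
      (lower_mul_raise_self q m) (lower_mul_raise_of_ne q hij) <;>
    rw [twist_mul_raise] <;>
    simp only [Pi.inv_apply, letterWeight_self, letterWeight_of_ne q hij, inv_inv]
  · obtain rfl : m = j := by omega
    refine commute_serreCubic_of_lie_right hq (k := cartan q m) (k' := cartanInv q m) ?_ ?_
      (lower_mul_raise_of_ne q hij.symm) (lower_mul_raise_self q m) <;>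
    rw [twist_mul_raise] <;>
    simp only [Pi.inv_apply, letterWeight_of_ne q hij.symm, inv_inv]

/-! ### The Serre submodule and the quotient module -/

variable (q) in
/-- The words-times-Serre-relation-times-word vectors, with their degree: `SerreVec q n v` says that
`v` is `u · S · w` with `S` the cubic Serre expression in the two letters, and `u`, `w` words of
total length `n - 4`. -/
inductive SerreVec : ℕ → WordSpace → Prop
  | base (i j : Fin 2) (h : i ≠ j) (w : List (Fin 2)) :
      SerreVec (w.length + 4) (serreCubic q (raise i) (raise j) (word w))
  | cons (j : Fin 2) (n : ℕ) (v : WordSpace) (h : SerreVec n v) : SerreVec (n + 1) (raise j v)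

variable (q) in
/-- The two-sided ideal generated by the cubic Serre expressions. -/
def serreSubmodule : Submodule ℂ WordSpace := Submodule.span ℂ {v | ∃ n, SerreVec q n v}

theorem SerreVec.mem {n : ℕ} {v : WordSpace} (h : SerreVec q n v) : v ∈ serreSubmodule q :=
  Submodule.subset_span ⟨n, h⟩

theorem map_mem_serreSubmodule {f : Module.End ℂ WordSpace}
    (h : ∀ n v, SerreVec q n v → f v ∈ serreSubmodule q) {v : WordSpace}
    (hv : v ∈ serreSubmodule q) : f v ∈ serreSubmodule q := by
  induction hv using Submodule.span_induction with
  | mem v hv => exact h _ _ hv.choose_spec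
  | zero => rw [map_zero]; exact zero_mem _
  | add v w _ _ hv hw => rw [map_add]; exact add_mem hv hw
  | smul c v _ hv => rw [map_smul]; exact Submodule.smul_mem _ c hv

theorem serreCubic_raise_mem {i j : Fin 2} (hij : i ≠ j) (v : WordSpace) :
    serreCubic q (raise i) (raise j) v ∈ serreSubmodule q := by
  induction v using Finsupp.induction_linear with
  | zero => rw [map_zero]; exact zero_mem _
  | add v w hv hw => rw [map_add]; exact add_mem hv hw
  | single w c =>
    rw [← mul_one c, ← smul_eq_mul, ← Finsupp.smul_single, map_smul]
    exact Submodule.smul_mem _ c (SerreVec.base i j hij w).mem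

theorem raise_mem_serreSubmodule (j : Fin 2) {v : WordSpace} (hv : v ∈ serreSubmodule q) :
    raise j v ∈ serreSubmodule q :=
  map_mem_serreSubmodule (fun n v h => (SerreVec.cons j n v h).mem) hv

theorem twist_mem_serreSubmodule (c : Fin 2 → ℂ) {v : WordSpace} (hv : v ∈ serreSubmodule q) :
    twist c v ∈ serreSubmodule q := by
  refine map_mem_serreSubmodule (fun n v h => ?_) hv
  induction h with
  | base i j h w =>
    have key : twist c (serreCubic q (raise i) (raise j) (word w)) =
        (c i ^ 3 * c j) • serreCubic q (raise i) (raise j) (twist c (word w)) :=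
      LinearMap.congr_fun (mul_serreCubic_of_mul_eq_smul (R := Module.End ℂ WordSpace) (q := q)
        (twist_mul_raise c i) (twist_mul_raise c j)) (word w)
    rw [key]
    exact Submodule.smul_mem _ _ (serreCubic_raise_mem h _)
  | cons j n v _ ih =>
    rw [twist_raise]
    exact Submodule.smul_mem _ _ (raise_mem_serreSubmodule j ih)

theorem lower_mem_serreSubmodule (hq : q ≠ 0) (i : Fin 2) {v : WordSpace}
    (hv : v ∈ serreSubmodule q) : lower q i v ∈ serreSubmodule q := by
  refine map_mem_serreSubmodule (fun n v h => ?_) hv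
  induction h with
  | base a b h w =>
    have := LinearMap.congr_fun (commute_lower_serreCubic_raise hq h i) (word w)
    rw [Module.End.mul_apply, Module.End.mul_apply] at this
    rw [this]
    exact serreCubic_raise_mem h _
  | cons j n v hv ih =>
    by_cases hij : i = j
    · subst hij
      have := LinearMap.congr_fun (lower_mul_raise_self q i) v
      rw [Module.End.mul_apply] at this
      rw [this]
      exact sub_mem (raise_mem_serreSubmodule i ih) (Submodule.smul_mem _ _
        (sub_mem (twist_mem_serreSubmodule _ hv.mem) (twist_mem_serreSubmodule _ hv.mem)))
    · have := LinearMap.congr_fun (lower_mul_raise_of_ne q hij) v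
      rw [Module.End.mul_apply] at this
      rw [this]
      exact raise_mem_serreSubmodule j ih

/-- The subalgebra of operators that preserve a submodule. -/
def stabilizer (N : Submodule ℂ WordSpace) : Subalgebra ℂ (Module.End ℂ WordSpace) where
  carrier := {f | ∀ v ∈ N, f v ∈ N}
  mul_mem' hf hg v hv := hf _ (hg v hv)
  add_mem' hf hg v hv := add_mem (hf v hv) (hg v hv)
  algebraMap_mem' c _ hv := N.smul_mem c hv

/-- The action on the quotient by a submodule of the operators that preserve it. -/
def quotEnd (N : Submodule ℂ WordSpace) : stabilizer N →ₐ[ℂ] Module.End ℂ (WordSpace ⧸ N) where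
  toFun f := N.mapQ N f.1 f.2
  map_one' := Submodule.linearMap_qext _ rfl
  map_zero' := Submodule.linearMap_qext _ rfl
  map_add' _ _ := Submodule.linearMap_qext _ rfl
  map_mul' _ _ := Submodule.linearMap_qext _ rfl
  commutes' _ := Submodule.linearMap_qext _ rfl

/-- The operators on words by which the generators of `ℒ` act. The nonzero scalars `γ i` rescale
`e_i⁺` and `e_i⁻` inversely to each other. -/
def genOp (hq : q ≠ 0) (γ : Fin 2 → ℂ) : LoopGen → stabilizer (serreSubmodule q)
  | .ep i => (γ i)⁻¹ • ⟨raise i, fun _ => raise_mem_serreSubmodule i⟩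
  | .em i => γ i • ⟨lower q i, fun _ => lower_mem_serreSubmodule hq i⟩
  | .k i => ⟨cartan q i, fun _ => twist_mem_serreSubmodule _⟩
  | .kinv i => ⟨cartanInv q i, fun _ => twist_mem_serreSubmodule _⟩

theorem cartan_mul_cartanInv (hq : q ≠ 0) (i : Fin 2) : cartan q i * cartanInv q i = 1 := by
  have h : letterWeight q i * (letterWeight q i)⁻¹ = 1 :=
    funext fun j => mul_inv_cancel₀ (letterWeight_ne_zero hq i j)
  rw [twist_mul_twist, h, twist_one]

theorem cartanInv_mul_cartan (hq : q ≠ 0) (i : Fin 2) : cartanInv q i * cartan q i = 1 := by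
  rw [twist_mul_twist, mul_comm, ← twist_mul_twist, cartan_mul_cartanInv hq]

theorem cartan_conj_of_mul {i : Fin 2} {f : Module.End ℂ WordSpace} {c : ℂ} (hq : q ≠ 0)
    (h : cartan q i * f = c • (f * cartan q i)) : cartan q i * f * cartanInv q i = c • f := by
  rw [h, smul_mul_assoc, mul_assoc, cartan_mul_cartanInv hq, mul_one]

theorem cartanInv_zero : cartanInv q 0 = cartan q 1 := by
  rw [cartanInv, letterWeight_zero_inv]

/-- The relations of `ℒ` hold for the operators `genOp`, up to the Serre submodule. -/
theorem loopRel_lift_genOp (hq : q ≠ 0) {γ : Fin 2 → ℂ} (hγ : ∀ i, γ i ≠ 0)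
    {a b : FreeAlgebra ℂ LoopGen} (h : LoopRel q a b) (v : WordSpace) :
    (FreeAlgebra.lift ℂ (genOp hq γ) a).1 v - (FreeAlgebra.lift ℂ (genOp hq γ) b).1 v ∈
      serreSubmodule q := by
  set T := (stabilizer (serreSubmodule q)).val.comp (FreeAlgebra.lift ℂ (genOp hq γ))
  change T a v - T b v ∈ serreSubmodule q
  have hT (x : LoopGen) : T (FreeAlgebra.ι ℂ x) = (genOp hq γ x).1 :=
    congrArg Subtype.val (FreeAlgebra.lift_ι_apply (genOp hq γ) x)
  have hep (i : Fin 2) : T (fep i) = (γ i)⁻¹ • raise i := hT (.ep i)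
  have hem (i : Fin 2) : T (fem i) = γ i • lower q i := hT (.em i)
  have hk (i : Fin 2) : T (fk i) = cartan q i := hT (.k i)
  have hkinv (i : Fin 2) : T (fkinv i) = cartanInv q i := hT (.kinv i)
  have hS (x y : FreeAlgebra ℂ LoopGen) :
      T ⁅x, x ^ 2 * y - (q ^ 2 + (q ^ 2)⁻¹) • (x * y * x) + y * x ^ 2⁆ =
        serreCubic q (T x) (T y) := by
    simp only [serreCubic, Ring.lie_def, map_sub, map_add, map_mul, map_smul, map_pow]
  have hw := letterWeight_ne_zero hq
  have of_eq (h : T a = T b) : T a v - T b v ∈ serreSubmodule q := by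
    rw [h, sub_self]; exact zero_mem _
  -- All relations but the Serre relations of the `e_i⁺` hold already on the space of words.
  cases h with
  | k0_k1 =>
    refine of_eq ?_
    rw [map_mul, map_one, hk, hk, ← cartanInv_zero, cartan_mul_cartanInv hq]
  | k1_k0 =>
    refine of_eq ?_
    rw [map_mul, map_one, hk, hk, ← cartanInv_zero, cartanInv_mul_cartan hq]
  | k_kinv i =>
    refine of_eq ?_
    rw [map_mul, map_one, hk, hkinv, cartan_mul_cartanInv hq]
  | kinv_k i =>
    refine of_eq ?_
    rw [map_mul, map_one, hk, hkinv, cartanInv_mul_cartan hq]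
  | k_ep_same i =>
    refine of_eq ?_
    rw [map_mul, map_mul, map_smul, hk, hkinv, hep]
    refine cartan_conj_of_mul hq ?_
    rw [mul_smul_comm, twist_mul_raise, smul_mul_assoc, letterWeight_self, smul_comm]
  | k_em_same i =>
    refine of_eq ?_
    rw [map_mul, map_mul, map_smul, hk, hkinv, hem]
    refine cartan_conj_of_mul hq ?_
    rw [mul_smul_comm, twist_mul_lower q (hw i i), smul_mul_assoc, letterWeight_self, smul_comm]
  | k_ep_ne i j hij =>
    refine of_eq ?_
    rw [map_mul, map_mul, map_smul, hk, hkinv, hep]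
    refine cartan_conj_of_mul hq ?_
    rw [mul_smul_comm, twist_mul_raise, smul_mul_assoc, letterWeight_of_ne q hij, smul_comm]
  | k_em_ne i j hij =>
    refine of_eq ?_
    rw [map_mul, map_mul, map_smul, hk, hkinv, hem]
    refine cartan_conj_of_mul hq ?_
    rw [mul_smul_comm, twist_mul_lower q (hw i j), smul_mul_assoc, letterWeight_of_ne q hij,
      inv_inv, smul_comm]
  | ep_em_same i =>
    refine of_eq ?_
    rw [Ring.lie_def, map_sub, map_mul, map_mul, map_smul, map_sub, hk, hkinv, hem, hep,
      smul_mul_smul_comm, smul_mul_smul_comm, inv_mul_cancel₀ (hγ i), mul_inv_cancel₀ (hγ i),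
      one_smul, one_smul, lower_mul_raise_self]
    module
  | ep_em_ne i j hij =>
    refine of_eq ?_
    rw [Ring.lie_def, map_sub, map_mul, map_mul, map_zero, hem, hep, smul_mul_smul_comm,
      smul_mul_smul_comm, lower_mul_raise_of_ne q hij.symm, mul_comm, sub_self]
  | serre_em i j hij =>
    refine of_eq ?_
    rw [map_zero]
    rw [hS, hem, hem, serreCubic_smul_left, serreCubic_smul_right, serreCubic_lower hq hij,
      smul_zero, smul_zero]
  | serre_ep i j hij =>
    rw [hS, hep, hep, serreCubic_smul_left, serreCubic_smul_right, map_zero, LinearMap.zero_apply,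
      sub_zero]
    exact Submodule.smul_mem _ _ (Submodule.smul_mem _ _ (serreCubic_raise_mem hij v))

/-- The action of `ℒ` on the quotient of the space of words by the Serre submodule. -/
def loopAction (hq : q ≠ 0) {γ : Fin 2 → ℂ} (hγ : ∀ i, γ i ≠ 0) :
    LoopAlgebra q →ₐ[ℂ] Module.End ℂ (WordSpace ⧸ serreSubmodule q) :=
  RingQuot.liftAlgHom ℂ ⟨(quotEnd _).comp (FreeAlgebra.lift ℂ (genOp hq γ)), fun _ _ h =>
    Submodule.linearMap_qext _ <| LinearMap.ext fun v =>
      (Submodule.Quotient.eq _).mpr (loopRel_lift_genOp hq hγ h v)⟩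

section Action

variable (hq : q ≠ 0) {γ : Fin 2 → ℂ} (hγ : ∀ i, γ i ≠ 0) (v : WordSpace)

theorem loopAction_gen (x : LoopGen) :
    loopAction hq hγ (RingQuot.mkAlgHom ℂ (LoopRel q) (FreeAlgebra.ι ℂ x))
      (Submodule.Quotient.mk v) = Submodule.Quotient.mk ((genOp hq γ x).1 v) := by
  rw [loopAction, RingQuot.liftAlgHom_mkAlgHom_apply, AlgHom.comp_apply, FreeAlgebra.lift_ι_apply]
  rfl

theorem loopAction_ep (i : Fin 2) : loopAction hq hγ (ep q i) (Submodule.Quotient.mk v) =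
    Submodule.Quotient.mk ((γ i)⁻¹ • raise i v) := loopAction_gen hq hγ v (.ep i)

theorem loopAction_em (i : Fin 2) : loopAction hq hγ (em q i) (Submodule.Quotient.mk v) =
    Submodule.Quotient.mk (γ i • lower q i v) := loopAction_gen hq hγ v (.em i)

theorem loopAction_k (i : Fin 2) :
    loopAction hq hγ (k q i : LoopAlgebra q) (Submodule.Quotient.mk v) =
      Submodule.Quotient.mk (cartan q i v) := loopAction_gen hq hγ v (.k i)

theorem loopAction_kinv (i : Fin 2) :
    loopAction hq hγ (((k q i)⁻¹ : (LoopAlgebra q)ˣ) : LoopAlgebra q) (Submodule.Quotient.mk v) =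
      Submodule.Quotient.mk (cartanInv q i v) := loopAction_gen hq hγ v (.kinv i)

end Action

/-! ### The length filtration and the leading term -/

/-- The span of the words of length less than `n`. -/
def lengthLT (n : ℕ) : Submodule ℂ WordSpace := Finsupp.supported ℂ ℂ {w | w.length < n}

/-- The span of the words of length `n`. -/
def lengthEq (n : ℕ) : Submodule ℂ WordSpace := Finsupp.supported ℂ ℂ {w | w.length = n}

theorem map_mem_of_mem_supported {M : Type*} [AddCommGroup M] [Module ℂ M] {S : Set (List (Fin 2))}
    {P : Submodule ℂ M} (f : WordSpace →ₗ[ℂ] M) (h : ∀ w ∈ S, f (word w) ∈ P) {v : WordSpace}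
    (hv : v ∈ Finsupp.supported ℂ ℂ S) : f v ∈ P := by
  rw [Finsupp.supported_eq_span_single] at hv
  have : Submodule.span ℂ ((fun w => word w) '' S) ≤ P.comap f := by
    rw [Submodule.span_le]
    rintro _ ⟨w, hw, rfl⟩
    exact h w hw
  exact this hv

theorem word_mem_lengthLT {n : ℕ} {w : List (Fin 2)} (h : w.length < n) : word w ∈ lengthLT n :=
  Finsupp.single_mem_supported ℂ 1 h

theorem word_mem_lengthEq (w : List (Fin 2)) : word w ∈ lengthEq w.length :=
  Finsupp.single_mem_supported ℂ 1 rfl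

theorem lengthLT_mono {m n : ℕ} (h : m ≤ n) : lengthLT m ≤ lengthLT n :=
  Finsupp.supported_mono fun _ hw => lt_of_lt_of_le hw h

theorem raise_mem_lengthLT (j : Fin 2) {n : ℕ} {v : WordSpace} (hv : v ∈ lengthLT n) :
    raise j v ∈ lengthLT (n + 1) := by
  refine map_mem_of_mem_supported (raise j) (fun w hw => ?_) hv
  rw [raise_word]
  exact word_mem_lengthLT (Nat.succ_lt_succ hw)

theorem raise_mem_lengthEq (j : Fin 2) {n : ℕ} {v : WordSpace} (hv : v ∈ lengthEq n) :
    raise j v ∈ lengthEq (n + 1) := by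
  refine map_mem_of_mem_supported (raise j) (fun w hw => ?_) hv
  rw [raise_word, ← show w.length = n from hw]
  exact word_mem_lengthEq (j :: w)

theorem twist_mem_lengthLT (c : Fin 2 → ℂ) {n : ℕ} {v : WordSpace} (hv : v ∈ lengthLT n) :
    twist c v ∈ lengthLT n := by
  refine map_mem_of_mem_supported (twist c) (fun w hw => ?_) hv
  rw [twist_word]
  exact Submodule.smul_mem _ _ (word_mem_lengthLT hw)

theorem lowerWord_mem_lengthLT (q : ℂ) (i : Fin 2) (w : List (Fin 2)) :
    lowerWord q i w ∈ lengthLT w.length := by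
  induction w with
  | nil => exact zero_mem _
  | cons j w ih =>
    refine sub_mem (raise_mem_lengthLT j ih) ?_
    split_ifs
    · have h : word w ∈ lengthLT (w.length + 1) := word_mem_lengthLT (Nat.lt_succ_self _)
      exact Submodule.smul_mem _ _ (sub_mem (twist_mem_lengthLT _ h) (twist_mem_lengthLT _ h))
    · exact zero_mem _

theorem lower_mem_lengthLT (q : ℂ) (i : Fin 2) {n : ℕ} {v : WordSpace} (hv : v ∈ lengthLT n) :
    lower q i v ∈ lengthLT n := by
  refine map_mem_of_mem_supported (lower q i) (fun w hw => ?_) hv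
  rw [lower_word]
  exact lengthLT_mono (le_of_lt hw) (lowerWord_mem_lengthLT q i w)

/-- The projection onto the span of the words of length `n`. -/
def lengthProj (n : ℕ) : Module.End ℂ WordSpace :=
  Finsupp.linearCombination ℂ fun w => if w.length = n then word w else 0

theorem lengthProj_word (n : ℕ) (w : List (Fin 2)) :
    lengthProj n (word w) = if w.length = n then word w else 0 := by
  rw [lengthProj, Finsupp.linearCombination_single, one_smul]

theorem lengthProj_of_mem_lengthEq {m n : ℕ} {v : WordSpace} (hv : v ∈ lengthEq m) :
    lengthProj n v = if m = n then v else 0 := by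
  split_ifs with h
  · rw [← sub_eq_zero, ← Submodule.mem_bot ℂ]
    refine map_mem_of_mem_supported (lengthProj n - LinearMap.id) (fun w hw => ?_) hv
    rw [LinearMap.sub_apply, lengthProj_word, if_pos (h ▸ hw), LinearMap.id_apply, sub_self]
    exact zero_mem _
  · rw [← Submodule.mem_bot ℂ]
    refine map_mem_of_mem_supported (lengthProj n) (fun w hw => ?_) hv
    rw [lengthProj_word, if_neg fun h' => h ((show w.length = m from hw) ▸ h')]
    exact zero_mem _

theorem lengthProj_of_mem_lengthLT {n : ℕ} {v : WordSpace} (hv : v ∈ lengthLT n) :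
    lengthProj n v = 0 := by
  rw [← Submodule.mem_bot ℂ]
  refine map_mem_of_mem_supported (lengthProj n) (fun w hw => ?_) hv
  rw [lengthProj_word, if_neg (ne_of_lt hw)]
  exact zero_mem _

theorem sub_lengthProj_mem {n : ℕ} {v : WordSpace} (hv : v ∈ lengthLT (n + 1)) :
    v - lengthProj n v ∈ lengthLT n := by
  refine map_mem_of_mem_supported (LinearMap.id - lengthProj n) (fun w hw => ?_) hv
  rw [LinearMap.sub_apply, lengthProj_word, LinearMap.id_apply]
  split_ifs with h
  · rw [sub_self]; exact zero_mem _
  · rw [sub_zero]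
    exact word_mem_lengthLT (lt_of_le_of_ne (Nat.le_of_lt_succ hw) h)

theorem SerreVec.mem_lengthEq {q : ℂ} {n : ℕ} {v : WordSpace} (h : SerreVec q n v) :
    v ∈ lengthEq n := by
  induction h with
  | base i j h w =>
    have hr (a b c d : Fin 2) :
        raise a (raise b (raise c (raise d (word w)))) ∈ lengthEq (w.length + 4) :=
      raise_mem_lengthEq a (raise_mem_lengthEq b (raise_mem_lengthEq c (raise_mem_lengthEq d
        (word_mem_lengthEq w))))
    simp only [serreCubic, Ring.lie_def, pow_two, LinearMap.sub_apply, LinearMap.add_apply,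
      LinearMap.smul_apply, Module.End.mul_apply, map_sub, map_add, map_smul]
    exact sub_mem (add_mem (sub_mem (hr ..) (Submodule.smul_mem _ _ (hr ..))) (hr ..))
      (add_mem (sub_mem (hr ..) (Submodule.smul_mem _ _ (hr ..))) (hr ..))
  | cons j n v _ ih => exact raise_mem_lengthEq j ih

/-! ### Injectivity -/

section Eval

variable (q : ℂ)

/-- The generators of the `q`-Onsager algebra as the images of the two letters. -/
def onsagerGen (j : Fin 2) : OnsagerAlgebra q := if j = 0 then z q else zstar q

/-- The evaluation of words in the generators of the `q`-Onsager algebra. -/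
def evalWord : WordSpace →ₗ[ℂ] OnsagerAlgebra q :=
  Finsupp.linearCombination ℂ fun w => (w.map (onsagerGen q)).prod

theorem evalWord_word (w : List (Fin 2)) :
    evalWord q (word w) = (w.map (onsagerGen q)).prod := by
  rw [evalWord, Finsupp.linearCombination_single, one_smul]

theorem evalWord_raise (j : Fin 2) (v : WordSpace) :
    evalWord q (raise j v) = onsagerGen q j * evalWord q v := by
  have : evalWord q ∘ₗ raise j = LinearMap.mulLeft ℂ (onsagerGen q j) ∘ₗ evalWord q := by
    refine Finsupp.lhom_ext' fun w => LinearMap.ext_ring ?_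
    change evalWord q (raise j (word w)) = onsagerGen q j * evalWord q (word w)
    rw [raise_word, evalWord_word, evalWord_word, List.map_cons, List.prod_cons]
  exact LinearMap.congr_fun this v

theorem serreCubic_onsagerGen {i j : Fin 2} (h : i ≠ j) :
    serreCubic q (onsagerGen q i) (onsagerGen q j) =
      delta q • ⁅onsagerGen q i, onsagerGen q j⁆ := by
  have hz := RingQuot.mkAlgHom_rel ℂ (OnsagerRel.td_z (q := q) _ _ rfl rfl)
  have hs := RingQuot.mkAlgHom_rel ℂ (OnsagerRel.td_zstar (q := q) _ _ rfl rfl)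
  simp only [Ring.lie_def, map_sub, map_add, map_mul, map_smul, map_pow] at hz hs
  fin_cases i <;> fin_cases j <;> first | exact absurd rfl h | skip
  · exact hz
  · exact hs

theorem evalWord_surjective : Function.Surjective (evalWord q) := by
  suffices h : ∀ (f : FreeAlgebra ℂ OnsagerGen) (v : WordSpace),
      ∃ u, evalWord q u = RingQuot.mkAlgHom ℂ (OnsagerRel q) f * evalWord q v by
    intro a
    obtain ⟨f, rfl⟩ := RingQuot.mkAlgHom_surjective ℂ (OnsagerRel q) a
    obtain ⟨u, hu⟩ := h f (word [])
    rw [evalWord_word, List.map_nil, List.prod_nil, mul_one] at hu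
    exact ⟨u, hu⟩
  intro f
  induction f with
  | grade0 r => exact fun v => ⟨r • v, by rw [AlgHom.commutes, map_smul, Algebra.smul_def]⟩
  | grade1 x =>
    intro v
    cases x with
    | z => exact ⟨raise 0 v, evalWord_raise q 0 v⟩
    | zstar => exact ⟨raise 1 v, evalWord_raise q 1 v⟩
  | mul f g hf hg =>
    intro v
    obtain ⟨u, hu⟩ := hg v
    obtain ⟨u', hu'⟩ := hf u
    exact ⟨u', by rw [hu', hu, map_mul, mul_assoc]⟩
  | add f g hf hg =>
    intro v
    obtain ⟨u, hu⟩ := hf v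
    obtain ⟨u', hu'⟩ := hg v
    exact ⟨u + u', by rw [map_add, hu, hu', map_add, add_mul]⟩

variable {q}

/-- In the `q`-Onsager algebra a vector of the Serre ideal can be rewritten with shorter words,
since its defining relations deform the Serre relations by terms of lower degree. -/
theorem SerreVec.exists_evalWord_eq {n : ℕ} {v : WordSpace} (h : SerreVec q n v) :
    ∃ u ∈ lengthLT n, evalWord q v = evalWord q u := by
  induction h with
  | base i j h w =>
    refine ⟨delta q • (raise i (raise j (word w)) - raise j (raise i (word w))),
      Submodule.smul_mem _ _ (sub_mem ?_ ?_), ?_⟩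
    · rw [raise_word, raise_word]
      exact word_mem_lengthLT (by simp only [List.length_cons]; omega)
    · rw [raise_word, raise_word]
      exact word_mem_lengthLT (by simp only [List.length_cons]; omega)
    · have h := congrArg (· * evalWord q (word w)) (serreCubic_onsagerGen q h)
      simp only [serreCubic, Ring.lie_def, pow_two, mul_sub, mul_add, sub_mul, add_mul,
        mul_smul_comm, smul_mul_assoc, mul_assoc] at h
      simp only [serreCubic, Ring.lie_def, pow_two, LinearMap.sub_apply, LinearMap.add_apply,
        LinearMap.smul_apply, Module.End.mul_apply, map_sub, map_add, map_smul, evalWord_raise]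
      exact h
  | cons j n v _ ih =>
    obtain ⟨u, hu, h⟩ := ih
    exact ⟨raise j u, raise_mem_lengthLT j hu, by rw [evalWord_raise, evalWord_raise, h]⟩

/-- The degree `n` component of a vector of the Serre ideal can be rewritten with words of length
less than `n` in the `q`-Onsager algebra. -/
theorem exists_evalWord_lengthProj_eq (n : ℕ) {v : WordSpace} (hv : v ∈ serreSubmodule q) :
    ∃ u ∈ lengthLT n, evalWord q (lengthProj n v) = evalWord q u := by
  induction hv using Submodule.span_induction with
  | mem v hv =>
    obtain ⟨m, hv⟩ := hv
    rw [lengthProj_of_mem_lengthEq hv.mem_lengthEq]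
    split_ifs with h
    · exact h ▸ hv.exists_evalWord_eq
    · exact ⟨0, zero_mem _, rfl⟩
  | zero => exact ⟨0, zero_mem _, by rw [map_zero]⟩
  | add v w _ _ hv hw =>
    obtain ⟨u, hu, h⟩ := hv
    obtain ⟨u', hu', h'⟩ := hw
    exact ⟨u + u', add_mem hu hu', by rw [map_add, map_add, map_add, h, h']⟩
  | smul c v _ hv =>
    obtain ⟨u, hu, h⟩ := hv
    exact ⟨c • u, Submodule.smul_mem _ c hu, by rw [map_smul, map_smul, map_smul, h]⟩

/-- A homomorphism from the `q`-Onsager algebra is injective if its target acts on the quotient of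
the space of words by the Serre ideal in such a way that each generator acts as left multiplication
by its letter, up to an operator that does not increase the length of words. -/
theorem injective_of_action {R : Type*} [Ring R] [Algebra ℂ R] (φ : OnsagerAlgebra q →ₐ[ℂ] R)
    (ρ : R →ₐ[ℂ] Module.End ℂ (WordSpace ⧸ serreSubmodule q)) (B : Fin 2 → Module.End ℂ WordSpace)
    (hB : ∀ j n, ∀ v ∈ lengthLT n, B j v ∈ lengthLT n)
    (hρ : ∀ j v, ρ (φ (onsagerGen q j)) (Submodule.Quotient.mk v) =
      Submodule.Quotient.mk (raise j v + B j v)) :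
    Function.Injective φ := by
  let ζ : List (Fin 2) → WordSpace :=
    List.foldr (fun j v => raise j v + B j v) (word [])
  have hζ (w : List (Fin 2)) : ζ w - word w ∈ lengthLT w.length := by
    induction w with
    | nil => exact (sub_self (word [])).symm ▸ zero_mem _
    | cons j w ih =>
      have h1 : ζ w ∈ lengthLT (w.length + 1) := by
        rw [← sub_add_cancel (ζ w) (word w)]
        exact add_mem (lengthLT_mono (Nat.le_succ _) ih) (word_mem_lengthLT (Nat.lt_succ_self _))
      have h2 : ζ (j :: w) - word (j :: w) = raise j (ζ w - word w) + B j (ζ w) := by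
        rw [map_sub, raise_word]
        exact add_sub_right_comm _ _ _
      rw [h2]
      exact add_mem (raise_mem_lengthLT j ih) (hB j _ _ h1)
  let Z : Module.End ℂ WordSpace := Finsupp.linearCombination ℂ ζ
  have hZw (w : List (Fin 2)) : Z (word w) = ζ w := by
    rw [Finsupp.linearCombination_single, one_smul]
  have hword (w : List (Fin 2)) : ρ (φ (evalWord q (word w))) (Submodule.Quotient.mk (word [])) =
      Submodule.Quotient.mk (ζ w) := by
    induction w with
    | nil =>
      rw [evalWord_word, List.map_nil, List.prod_nil, map_one, map_one]
      rfl
    | cons j w ih =>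
      rw [← raise_word, evalWord_raise, map_mul, map_mul, Module.End.mul_apply, ih, hρ]
      rfl
  -- `Z v` represents the vector obtained by acting on the empty word with `φ (evalWord q v)`.
  have hZ (v : WordSpace) : ρ (φ (evalWord q v)) (Submodule.Quotient.mk (word [])) =
      Submodule.Quotient.mk (Z v) := by
    induction v using Finsupp.induction_linear with
    | zero => simp only [map_zero, LinearMap.zero_apply, Submodule.Quotient.mk_zero]
    | add v w hv hw =>
      simp only [map_add, LinearMap.add_apply, Submodule.Quotient.mk_add, hv, hw]
    | single w c =>
      rw [← mul_one c, ← smul_eq_mul, ← Finsupp.smul_single]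
      simp only [map_smul, LinearMap.smul_apply, Submodule.Quotient.mk_smul]
      rw [hword, hZw]
  have hlow {n : ℕ} {v : WordSpace} (hv : v ∈ lengthLT (n + 1)) : Z v - v ∈ lengthLT n := by
    refine map_mem_of_mem_supported (Z - LinearMap.id) (fun w hw => ?_) hv
    rw [LinearMap.sub_apply, hZw, LinearMap.id_apply]
    exact lengthLT_mono (Nat.le_of_lt_succ hw) (hζ w)
  have main (n : ℕ) : ∀ v ∈ lengthLT n, φ (evalWord q v) = 0 → evalWord q v = 0 := by
    induction n with
    | zero =>
      intro v hv _
      have : v ∈ (⊥ : Submodule ℂ WordSpace) :=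
        map_mem_of_mem_supported LinearMap.id (fun w hw => absurd hw (Nat.not_lt_zero _)) hv
      rw [(Submodule.mem_bot ℂ).mp this, map_zero]
    | succ n ih =>
      intro v hv h0
      have hN : Z v ∈ serreSubmodule q := by
        rw [← Submodule.Quotient.mk_eq_zero, ← hZ, h0, map_zero, LinearMap.zero_apply]
      obtain ⟨u, hu, hu'⟩ := exists_evalWord_lengthProj_eq n hN
      -- `Z v` and `v` have the same leading term.
      have hp : lengthProj n (Z v) = lengthProj n v := by
        rw [← sub_eq_zero, ← map_sub, lengthProj_of_mem_lengthLT (hlow hv)]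
      have e : evalWord q v = evalWord q (u + (v - lengthProj n v)) := by
        rw [map_add, ← hu', hp, map_sub, add_sub_cancel]
      rw [e] at h0 ⊢
      exact ih _ (add_mem hu (sub_lengthProj_mem hv)) h0
  rw [injective_iff_map_eq_zero]
  intro a ha
  obtain ⟨v, rfl⟩ := evalWord_surjective q a
  refine main (v.support.sup List.length + 1) v ?_ ha
  rw [lengthLT, Finsupp.mem_supported]
  exact fun w hw => Nat.lt_succ_of_le (Finset.le_sup (f := List.length) hw)

end Eval

theorem alpha_ne_zero {q : ℂ} (hq : q ≠ 0) (hq1 : q ^ 2 ≠ 1) : alpha q ≠ 0 :=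
  mul_ne_zero (neg_ne_zero.mpr (inv_ne_zero hq)) (pow_ne_zero 2 (sub_inv_ne_zero hq hq1))

theorem onsagerToLoop_injective {q s t : ℂ} (hq : q ≠ 0) (hq1 : q ^ 2 ≠ 1) (hs : s ≠ 0)
    (ht : t ≠ 0) : Function.Injective (onsagerToLoop hq hq1 hs ht) := by
  have hα := alpha_ne_zero hq hq1
  -- With this scaling the leading terms of `z_t(s)` and `z*_t(s)` act as multiplication by a
  -- letter.
  let γ : Fin 2 → ℂ := ![alpha q * s, s⁻¹]
  have hγ : ∀ i, γ i ≠ 0 := by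
    intro i
    fin_cases i
    · exact mul_ne_zero hα hs
    · exact inv_ne_zero hs
  let B : Fin 2 → Module.End ℂ WordSpace := ![
    (alpha q * s⁻¹ * γ 1) • (lower q 1 * cartan q 1) + (t * s) • cartan q 0 +
      (t⁻¹ * s⁻¹) • cartanInv q 0,
    (s * γ 0) • (lower q 0 * cartan q 0) + (t⁻¹ * s) • cartan q 0 + (t * s⁻¹) • cartanInv q 0]
  refine injective_of_action _ (loopAction hq hγ) B (fun j n v hv => ?_) (fun j v => ?_)
  · have hc (c : Fin 2 → ℂ) := twist_mem_lengthLT c hv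
    fin_cases j <;>
    exact add_mem (add_mem (Submodule.smul_mem _ _ (lower_mem_lengthLT q _ (hc _)))
      (Submodule.smul_mem _ _ (hc _))) (Submodule.smul_mem _ _ (hc _))
  · fin_cases j
    · have e : alpha q * s * (γ 0)⁻¹ = 1 := mul_inv_cancel₀ (hγ 0)
      change loopAction hq hγ (onsagerToLoop hq hq1 hs ht (z q)) _ =
        Submodule.Quotient.mk (raise 0 v + ((alpha q * s⁻¹ * γ 1) • lower q 1 (cartan q 1 v) +
          (t * s) • cartan q 0 v + (t⁻¹ * s⁻¹) • cartanInv q 0 v))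
      rw [onsagerToLoop_z, zT, xS, val_kS, val_inv_kS]
      simp only [map_add, map_smul, map_mul, LinearMap.add_apply, LinearMap.smul_apply,
        Module.End.mul_apply, loopAction_ep, loopAction_em, loopAction_k, loopAction_kinv,
        ← Submodule.Quotient.mk_smul, ← Submodule.Quotient.mk_add]
      congr 1
      linear_combination (norm := module) e • raise 0 v
    · have e : s⁻¹ * (γ 1)⁻¹ = 1 := mul_inv_cancel₀ (hγ 1)
      change loopAction hq hγ (onsagerToLoop hq hq1 hs ht (zstar q)) _ =
        Submodule.Quotient.mk (raise 1 v + ((s * γ 0) • lower q 0 (cartan q 0 v) +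
          (t⁻¹ * s) • cartan q 0 v + (t * s⁻¹) • cartanInv q 0 v))
      rw [onsagerToLoop_zstar, zstarT, yS, val_kS, val_inv_kS]
      simp only [map_add, map_smul, map_mul, LinearMap.add_apply, LinearMap.smul_apply,
        Module.End.mul_apply, loopAction_ep, loopAction_em, loopAction_k, loopAction_kinv,
        ← Submodule.Quotient.mk_smul, ← Submodule.Quotient.mk_add]
      congr 1
      linear_combination (norm := module) e • raise 1 v

end

end QOnsager

theorem proposition1 (q : ℂ) (hq0 : q ≠ 0) (hq : ∀ n : ℕ, 0 < n → q ^ n ≠ 1)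
    (s t : ℂ) (hs : s ≠ 0) (ht : t ≠ 0) :
    ∃ φ : QOnsager.OnsagerAlgebra q →ₐ[ℂ] QOnsager.LoopAlgebra q,
      φ (QOnsager.z q) = QOnsager.zT q s t hs ∧
      φ (QOnsager.zstar q) = QOnsager.zstarT q s t hs ∧
      Function.Injective φ := by
  have hq1 : q ^ 2 ≠ 1 := hq 2 two_pos
  exact ⟨QOnsager.onsagerToLoop hq0 hq1 hs ht, QOnsager.onsagerToLoop_z hq0 hq1 hs ht,
    QOnsager.onsagerToLoop_zstar hq0 hq1 hs ht, QOnsager.onsagerToLoop_injective hq0 hq1 hs ht⟩
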